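/- Let $\Gamma$ be a discrete group that is non-i.c.c., i.e. some element $g\neq e$ of $\Gamma$ has a finite conjugacy class, and let $\Gamma_f$ be its FC-center, the union of all finite conjugacy classes of $\Gamma$. If a unital $C^*$-algebra $\mathcal A$ carries an action of $\Gamma$ by $*$-automorphisms and $\pi:\mathcal A\to\mathbb B(\mathcal H)$ is a faithful unital $*$-representation, then $\mathcal A\rtimes_r\Gamma$ denotes the $C^*$-algebra generated in $\mathbb B(\ell^2(\Gamma,\mathcal H))$ by the operators $(\sigma(a)\xi)(t)=\pi(t^{-1}a)\xi(t)$, $a\in\mathcal A$, and $(\lambda_s\xi)(t)=\xi(s^{-1}t)$, $s\in\Gamma$. For a $\Gamma$-invariant $C^*$-subalgebra $\mathcal D\subset\mathcal A$ containing $1_{\mathcal A}$, $\mathcal D\rtimes_r\Gamma\subset\mathcal A\rtimes_r\Gamma$ is the $C^*$-algebra generated by $\sigma(\mathcal D)$ and all $\lambda_s$; for a subgroup $N\le\Gamma$, $C^*_r(N)\subset\mathcal A\rtimes_r\Gamma$ is the $C^*$-algebra generated by $\{\lambda_s:s\in N\}$. Put $$J=\overline{\Big\{\sum_{s\in F}c_s\lambda_s:\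 F\subset\Gamma_f \text{ finite},\ c_s\in\mathbb C,\ \sum_{s\in F} c_s=0\Big\}}\subset C^*_r(\Gamma_f),\qquad I=\overline{\mathrm{span}}\{\eta a:\eta\in J,\ a\in C^*_r(\Gamma)\},$$ $$\mathcal A_I=\mathrm{span}\{\eta x\eta':\eta,\eta'\in I,\ x\in\mathcal A\rtimes_r\Gamma\},\qquad \mathcal B=C^*_r(\Gamma)+\overline{\mathcal A_I}.$$ 1. Suppose $|\Gamma_f|>2$ and $\mathcal A\neq\mathbb C$ is a unital $\Gamma$-$C^*$-algebra that has a faithful $\Gamma$-invariant state. Then, for every faithful unital $*$-representation $\pi$ of $\mathcal A$, $\mathcal B$ is a $C^*$-algebra with $C^*_r(\Gamma)\subset\mathcal B\subset\mathcal A\rtimes_r\Gamma$, and $\mathcal B$ is not a crossed product in the canonical way, i.e. there is no $\Gamma$-invariant $C^*$-subalgebra $\mathcal D\subset\mathcal A$ containing $1_{\mathcal A}$ with $\mathcal B=\mathcal D\rtimes_r\Gamma$. 2. Let $X$ be a compact Hausdorff space with $|X|>2$ on which $\Gamma$ acts by homeomorphisms, and suppose that $X$ has a $\Gamma$-invariant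 Borel probability measure with full support. Let $\Gamma$ act on $\mathcal A=C(X)$ by $(gf)(x)=f(g^{-1}x)$. Then the same conclusion holds for $\mathcal A=C(X)$, with no condition on $|\Gamma_f|$. -/

import Mathlib

open scoped ENNReal ComplexOrder Pointwise

universe u v w

noncomputable section

namespace CrossedProd

/-! ### Groups -/

/-- `Γ` is i.c.c.: every non-trivial element has an infinite conjugacy class
(equivalently, the FC-center is trivial). -/
def IsICC (Γ : Type u) [Group Γ] : Prop :=
  ∀ g : Γ, g ≠ 1 → (conjugatesOf g).Infinite

/-- The FC-center of `Γ`: the union of all finite conjugacy classes. -/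
def fcCenter (Γ : Type u) [Group Γ] : Subgroup Γ where
  carrier := {g | (conjugatesOf g).Finite}
  one_mem' := by
    refine (Set.finite_singleton (1 : Γ)).subset ?_
    intro x hx
    obtain ⟨c, rfl⟩ := isConj_iff.1 (show IsConj _ x from hx)
    simp
  mul_mem' := by
    intro a b ha hb
    refine (Set.Finite.mul ha hb).subset ?_
    intro x hx
    obtain ⟨c, rfl⟩ := isConj_iff.1 (show IsConj _ x from hx)
    refine Set.mem_mul.2 ⟨c * a * c⁻¹, ?_, c * b * c⁻¹, ?_, by group⟩
    · exact isConj_iff.2 ⟨c, rfl⟩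
    · exact isConj_iff.2 ⟨c, rfl⟩
  inv_mem' := by
    intro a ha
    refine (Set.Finite.inv ha).subset ?_
    intro x hx
    obtain ⟨c, rfl⟩ := isConj_iff.1 (show IsConj _ x from hx)
    refine Set.mem_inv.2 (isConj_iff.2 ⟨c, by group⟩)

/-! ### Invariant states -/

/-- `φ` is a faithful `Γ`-invariant state for the action `α` of `Γ` on `A` by *-automorphisms. -/
structure IsFaithfulInvariantState {Γ : Type u} [Group Γ] {A : Type v} [CStarAlgebra A]
    (α : Γ →* (A ≃⋆ₐ[ℂ] A)) (φ : A →ₗ[ℂ] ℂ) : Prop where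
  nonneg : ∀ a : A, 0 ≤ φ (star a * a)
  map_one : φ 1 = 1
  faithful : ∀ a : A, φ (star a * a) = 0 → a = 0
  invariant : ∀ (g : Γ) (a : A), φ (α g a) = φ a

/-! ### Operators on `ℓ²(Γ, H)` -/

/-- The Hilbert space `ℓ²(Γ, H)` of square-summable `H`-valued functions on `Γ`. -/
abbrev L2 (Γ : Type u) (H : Type w) [NormedAddCommGroup H] : Type (max u w) :=
  lp (fun _ : Γ => H) 2

section Operators

variable {Γ : Type u} [Group Γ] {H : Type w} [NormedAddCommGroup H]

theorem memlp_translate (s : Γ) (ξ : L2 Γ H) :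
    Memℓp (fun t : Γ => (ξ : Γ → H) (s⁻¹ * t)) 2 := by
  have h := (memℓp_gen_iff (p := (2 : ℝ≥0∞)) (by norm_num)).1 (lp.memℓp ξ)
  refine (memℓp_gen_iff (by norm_num)).2 ?_
  exact h.comp_injective (mul_right_injective s⁻¹)

theorem norm_translate (s : Γ) (ξ : L2 Γ H) :
    ‖(⟨fun t : Γ => (ξ : Γ → H) (s⁻¹ * t), memlp_translate s ξ⟩ : L2 Γ H)‖ = ‖ξ‖ := by
  have hp : 0 < (2 : ℝ≥0∞).toReal := by norm_num
  rw [lp.norm_eq_tsum_rpow hp, lp.norm_eq_tsum_rpow hp]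
  congr 1
  exact (Equiv.mulLeft s⁻¹).tsum_eq (fun t => ‖(ξ : Γ → H) t‖ ^ (2 : ℝ≥0∞).toReal)

variable [InnerProductSpace ℂ H]

/-- Left translation: `(λ_s ξ)(t) = ξ(s⁻¹ t)`. -/
def translation (H : Type w) [NormedAddCommGroup H] [InnerProductSpace ℂ H] (s : Γ) :
    L2 Γ H →L[ℂ] L2 Γ H :=
  LinearMap.mkContinuous
    { toFun := fun ξ => ⟨fun t => (ξ : Γ → H) (s⁻¹ * t), memlp_translate s ξ⟩
      map_add' := fun _ _ => rfl
      map_smul' := fun _ _ => rfl } 1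
    (fun ξ => by rw [one_mul]; exact (norm_translate s ξ).le)

@[simp] theorem translation_apply (s : Γ) (ξ : L2 Γ H) (t : Γ) :
    (translation H s ξ : Γ → H) t = (ξ : Γ → H) (s⁻¹ * t) := rfl

variable [CompleteSpace H] {A : Type v} [CStarAlgebra A]

theorem norm_coeff_le (α : Γ →* (A ≃⋆ₐ[ℂ] A)) (π : A →⋆ₐ[ℂ] (H →L[ℂ] H)) (a : A) (t : Γ)
    (x : H) : ‖π (α t⁻¹ a) x‖ ≤ ‖((‖a‖ : ℝ) : ℂ) • x‖ := by
  have h1 : ‖π (α t⁻¹ a)‖ ≤ ‖a‖ :=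
    (NonUnitalStarAlgHom.norm_apply_le π _).trans (NonUnitalStarAlgHom.norm_apply_le (α t⁻¹) a)
  refine ((π (α t⁻¹ a)).le_of_opNorm_le h1 x).trans (le_of_eq ?_)
  rw [norm_smul, Complex.norm_real, norm_norm]

theorem memlp_coeff (α : Γ →* (A ≃⋆ₐ[ℂ] A)) (π : A →⋆ₐ[ℂ] (H →L[ℂ] H)) (a : A) (ξ : L2 Γ H) :
    Memℓp (fun t : Γ => π (α t⁻¹ a) ((ξ : Γ → H) t)) 2 := by
  have h := (memℓp_gen_iff (p := (2 : ℝ≥0∞)) (by norm_num)).1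
    (lp.memℓp (((‖a‖ : ℝ) : ℂ) • ξ))
  refine (memℓp_gen_iff (by norm_num)).2 (h.of_nonneg_of_le (fun t => by positivity) fun t => ?_)
  exact Real.rpow_le_rpow (norm_nonneg _) (norm_coeff_le α π a t _) (by norm_num)

/-- The representation `σ` of `A` on `ℓ²(Γ, H)`: `(σ(a) ξ)(t) = π(t⁻¹ a) ξ(t)`. -/
def coeffRep (α : Γ →* (A ≃⋆ₐ[ℂ] A)) (π : A →⋆ₐ[ℂ] (H →L[ℂ] H)) (a : A) :
    L2 Γ H →L[ℂ] L2 Γ H :=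
  LinearMap.mkContinuous
    { toFun := fun ξ => ⟨fun t => π (α t⁻¹ a) ((ξ : Γ → H) t), memlp_coeff α π a ξ⟩
      map_add' := fun ξ η => by
        apply lp.ext; funext t
        exact map_add (π (α t⁻¹ a)) _ _
      map_smul' := fun c ξ => by
        apply lp.ext; funext t
        exact map_smul (π (α t⁻¹ a)) c _ } ‖a‖
    (fun ξ => by
      have h : ‖((‖a‖ : ℝ) : ℂ) • ξ‖ = ‖a‖ * ‖ξ‖ := by
        rw [norm_smul, Complex.norm_real, norm_norm]
      rw [← h]
      exact lp.norm_mono (by norm_num) (fun t => norm_coeff_le α π a t _))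

@[simp] theorem coeffRep_apply (α : Γ →* (A ≃⋆ₐ[ℂ] A)) (π : A →⋆ₐ[ℂ] (H →L[ℂ] H)) (a : A)
    (ξ : L2 Γ H) (t : Γ) :
    (coeffRep α π a ξ : Γ → H) t = π (α t⁻¹ a) ((ξ : Γ → H) t) := rfl

/-! ### Reduced crossed products inside `B(ℓ²(Γ, H))` -/

/-- For a *-subalgebra `D` of `A`, the C*-algebra generated by `σ(D)` and the `λ_s`, `s ∈ Γ`.
For `Γ`-invariant closed `D` this is `D ⋊_r Γ`. -/
def crossedProductOf (α : Γ →* (A ≃⋆ₐ[ℂ] A)) (π : A →⋆ₐ[ℂ] (H →L[ℂ] H))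
    (D : StarSubalgebra ℂ A) : StarSubalgebra ℂ (L2 Γ H →L[ℂ] L2 Γ H) :=
  (StarAlgebra.adjoin ℂ
    (coeffRep α π '' (D : Set A) ∪ Set.range (translation (Γ := Γ) H))).topologicalClosure

/-- The reduced crossed product `A ⋊_r Γ`. -/
def crossedProduct (α : Γ →* (A ≃⋆ₐ[ℂ] A)) (π : A →⋆ₐ[ℂ] (H →L[ℂ] H)) :
    StarSubalgebra ℂ (L2 Γ H →L[ℂ] L2 Γ H) :=
  crossedProductOf α π ⊤

/-- The copy of `C*_r(N)`, for a subgroup `N` of `Γ`, in `A ⋊_r Γ`: the C*-algebra generated by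
the `λ_s`, `s ∈ N`. -/
def reducedGroupAlgebra (H : Type w) [NormedAddCommGroup H] [InnerProductSpace ℂ H]
    [CompleteSpace H] (N : Subgroup Γ) : StarSubalgebra ℂ (L2 Γ H →L[ℂ] L2 Γ H) :=
  (StarAlgebra.adjoin ℂ (translation H '' (N : Set Γ))).topologicalClosure

/-! ### The intermediate algebra of the augmentation ideal -/

/-- The augmentation ideal of `C*_r(N)`: the closure of the set of finite sums `∑ c_s λ_s`,
`s ∈ N`, with `∑ c_s = 0`. -/
def augmentationIdeal (H : Type w) [NormedAddCommGroup H] [InnerProductSpace ℂ H]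
    (N : Subgroup Γ) : Set (L2 Γ H →L[ℂ] L2 Γ H) :=
  closure {T | ∃ c : N →₀ ℂ, (c.sum fun _ z => z) = 0 ∧
    T = c.sum fun s z => z • translation H (s : Γ)}

/-- The closed ideal of `C*_r(Γ)` induced by `J ⊆ C*_r(N)`: the closed span of all `η a` with
`η ∈ J` and `a ∈ C*_r(Γ)`. -/
def inducedIdeal (J : Set (L2 Γ H →L[ℂ] L2 Γ H)) : Set (L2 Γ H →L[ℂ] L2 Γ H) :=
  closure (Submodule.span ℂ
    {T | ∃ η ∈ J, ∃ a ∈ reducedGroupAlgebra H (⊤ : Subgroup Γ), T = η * a} :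
      Set (L2 Γ H →L[ℂ] L2 Γ H))

/-- The closed span of all `η x η'` with `η, η' ∈ I` and `x ∈ A ⋊_r Γ`. -/
def sandwich (α : Γ →* (A ≃⋆ₐ[ℂ] A)) (π : A →⋆ₐ[ℂ] (H →L[ℂ] H))
    (I : Set (L2 Γ H →L[ℂ] L2 Γ H)) : Set (L2 Γ H →L[ℂ] L2 Γ H) :=
  closure (Submodule.span ℂ
    {T | ∃ η ∈ I, ∃ x ∈ crossedProduct α π, ∃ η' ∈ I, T = η * x * η'} :
      Set (L2 Γ H →L[ℂ] L2 Γ H))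

/-- The set `C*_r(Γ) + closure (A_I)`, where `I` is the ideal of `C*_r(Γ)` induced by the
augmentation ideal of `C*_r(Γ_f)`. -/
def augmentationSum (α : Γ →* (A ≃⋆ₐ[ℂ] A)) (π : A →⋆ₐ[ℂ] (H →L[ℂ] H)) :
    Set (L2 Γ H →L[ℂ] L2 Γ H) :=
  (reducedGroupAlgebra H (⊤ : Subgroup Γ) : Set (L2 Γ H →L[ℂ] L2 Γ H)) +
    sandwich α π (inducedIdeal (augmentationIdeal H (fcCenter Γ)))

/-- `B` is an intermediate C*-algebra `C*_r(Γ) ⊆ B ⊆ A ⋊_r Γ`. -/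
structure IsIntermediate (α : Γ →* (A ≃⋆ₐ[ℂ] A)) (π : A →⋆ₐ[ℂ] (H →L[ℂ] H))
    (B : StarSubalgebra ℂ (L2 Γ H →L[ℂ] L2 Γ H)) : Prop where
  isClosed : IsClosed (B : Set (L2 Γ H →L[ℂ] L2 Γ H))
  le_left : reducedGroupAlgebra H (⊤ : Subgroup Γ) ≤ B
  le_right : B ≤ crossedProduct α π

/-- `B` is a crossed product in the canonical way: `B = D ⋊_r Γ` for a `Γ`-invariant
C*-subalgebra `D` of `A`. -/
def IsCanonicalCrossedProduct (α : Γ →* (A ≃⋆ₐ[ℂ] A)) (π : A →⋆ₐ[ℂ] (H →L[ℂ] H))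
    (B : StarSubalgebra ℂ (L2 Γ H →L[ℂ] L2 Γ H)) : Prop :=
  ∃ D : StarSubalgebra ℂ A, IsClosed (D : Set A) ∧ (∀ (g : Γ), ∀ d ∈ D, α g d ∈ D) ∧
    B = crossedProductOf α π D

end Operators

/-! ### The action on `C(X)` -/

/-- The action of `Γ` on `C(X)` induced by an action on `X` by homeomorphisms:
`(g f)(x) = f(g⁻¹ x)`. -/
def actionOnFunctions (Γ : Type u) [Group Γ] (X : Type v) [TopologicalSpace X] [CompactSpace X]
    [MulAction Γ X] [ContinuousConstSMul Γ X] : Γ →* (C(X, ℂ) ≃⋆ₐ[ℂ] C(X, ℂ)) where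
  toFun g := (Homeomorph.smul g⁻¹).compStarAlgEquiv' ℂ ℂ
  map_one' := by
    ext f x
    change f ((1 : Γ)⁻¹ • x) = f x
    simp
  map_mul' g h := by
    ext f x
    change f ((g * h)⁻¹ • x) = f (h⁻¹ • g⁻¹ • x)
    rw [mul_inv_rev, mul_smul]

@[simp] theorem actionOnFunctions_apply {Γ : Type u} [Group Γ] {X : Type v} [TopologicalSpace X]
    [CompactSpace X] [MulAction Γ X] [ContinuousConstSMul Γ X] (g : Γ) (f : C(X, ℂ)) (x : X) :
    actionOnFunctions Γ X g f x = f (g⁻¹ • x) := rfl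

end CrossedProd

end

noncomputable section

namespace CrossedProd

/-! ### Følner sets in the FC-center -/

/-! Write `I` for the ideal and `K` for the closed sandwich span, so that the algebra in question is
`C*_r(Γ) + K`. Everything rests on the amenability of the FC-center: a finite conjugation invariant
set has powers of polynomial growth, hence some of its powers are Følner sets `F`.

Closedness of the sum. The averages `f` of the `λ_t` over Følner sets have norm at most one, satisfy
`1 - f ∈ I`, and asymptotically annihilate `I`, hence also `K`. So the `C*_r(Γ)`-part of `c + k` can
be corrected by an element of `K` until it is bounded by a multiple of `‖c + k‖`, and
`isClosed_add_of_bounded` applies. The algebraic properties hold because `I` is a self-adjoint ideal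
of `C*_r(Γ)`.

Not a crossed product. Suppose the algebra is `D ⋊_r Γ`. The claim is that `D` is both too small and
too big. Small: compress operators by the normalized indicator of `F` and apply an extension of the
invariant state `φ`. These functionals tend to zero on `K` and satisfy `σ(a) c ↦ φ(a) · (value at
c)` for `c ∈ C*_r(Γ)`. Writing `σ(d) = c + k` yields `φ(d* d) = φ(d*) φ(d)` for `d ∈ D`
(`IsFaithfulInvariantState.map_star_mul_self`); since `φ` is faithful, `d` is a scalar. Big: for
nontrivial `g, h` in the FC-center, the coefficient at the identity of `(λ_g - 1) σ(a) (λ_h - 1) ∈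
K` lies in `D`. It is `a` if `gh ≠ 1`, and `g a + a` if `h = g⁻¹`. The first case contradicts `A ≠
ℂ` when the FC-center has more than two elements; the second needs only one nontrivial `g` and a
function `f` on `X` with `g f + f` not constant. -/

/-- If any two letters can be interchanged at the cost of conjugating the second one, then every
word can be sorted without changing its length and its value. -/
theorem exists_sorted_word {G : Type*} [Group G] {k : ℕ} (v : Fin k → G)
    (hv : ∀ i j, ∃ l, v i * v j = v j * v l) (w : List (Fin k)) :
    ∃ w' : List (Fin k), w'.length = w.length ∧ (w'.map v).prod = (w.map v).prod ∧
      w'.Pairwise (· ≤ ·) := by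
  set M : Set (List (Fin k)) :=
    {w' | w'.length = w.length ∧ (w'.map v).prod = (w.map v).prod}
  have hfin : M.Finite := (List.finite_length_eq (Fin k) w.length).subset fun _ h => h.1
  -- The lexicographically least word of this length and value is sorted: replacing an adjacent
  -- descent `a b` by `b c` would give a smaller one.
  obtain ⟨m, hm⟩ := hfin.exists_minimal ⟨w, rfl, rfl⟩
  refine ⟨m, hm.prop.1, hm.prop.2, List.isChain_iff_pairwise.1 ?_⟩
  rw [List.isChain_iff_forall_rel_of_append_cons_cons]
  intro a b l₁ l₂ h
  by_contra hab
  rw [not_le] at hab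
  obtain ⟨c, hc⟩ := hv a b
  have hmem : l₁ ++ b :: c :: l₂ ∈ M := by
    refine ⟨?_, ?_⟩
    · rw [← hm.prop.1, h]; simp
    · rw [← hm.prop.2, h]
      simp only [List.map_append, List.map_cons, List.prod_append, List.prod_cons, ← mul_assoc]
      rw [mul_assoc _ (v b) (v c), ← hc, mul_assoc _ (v a) (v b)]
  have hlt : l₁ ++ b :: c :: l₂ < m := by
    rw [h]
    exact List.append_left_lt (List.Lex.rel hab)
  exact hm.not_lt hmem hlt

/-- The powers of a finite conjugation invariant set grow polynomially. -/
theorem card_pow_le_of_conj_invariant {G : Type*} [Group G] [DecidableEq G] (S : Finset G)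
    (hS : ∀ g, ∀ s ∈ S, g⁻¹ * s * g ∈ S) (n : ℕ) : (S ^ n).card ≤ (n + 1) ^ S.card := by
  classical
  set k := S.card
  let e : S ≃ Fin k := S.equivFin
  let v : Fin k → G := fun i => (e.symm i : G)
  have hv : ∀ i j, ∃ l, v i * v j = v j * v l := fun i j =>
    ⟨e ⟨(v j)⁻¹ * v i * v j, hS _ _ (e.symm i).2⟩, by simp [v, mul_assoc]⟩
  -- A sorted word is determined by its letter counts, each between `0` and `n`; this is the source
  -- of the bound `(n + 1) ^ k`.
  let f : (Fin k → Fin (n + 1)) → G := fun c =>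
    (((∑ i, (c i : ℕ) • ({i} : Multiset (Fin k))).sort (· ≤ ·)).map v).prod
  have hword : ∀ (n : ℕ), ∀ g ∈ S ^ n, ∃ w : List (Fin k), w.length = n ∧ (w.map v).prod = g := by
    intro n
    induction n with
    | zero => intro g hg; exact ⟨[], rfl, by
        rw [pow_zero, Finset.mem_one] at hg
        simp [hg]⟩
    | succ n ih =>
      intro g hg
      rw [pow_succ', Finset.mem_mul] at hg
      obtain ⟨s, hs, t, ht, rfl⟩ := hg
      obtain ⟨w, hw, rfl⟩ := ih t ht
      exact ⟨e ⟨s, hs⟩ :: w, by simp [hw], by simp [v]⟩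
  have hsub : S ^ n ⊆ Finset.univ.image f := by
    intro g hg
    obtain ⟨w₀, hw₀, rfl⟩ := hword n g hg
    obtain ⟨w, hlen, hprod, hsort⟩ := exists_sorted_word v hv w₀
    refine Finset.mem_image.2 ⟨fun i => ⟨w.count i, ?_⟩, Finset.mem_univ _, ?_⟩
    · have := List.count_le_length (a := i) (l := w)
      omega
    · rw [← hprod]
      have h1 : (∑ i, w.count i • ({i} : Multiset (Fin k))) = (w : Multiset (Fin k)) := by
        ext j
        simp [Multiset.count_sum', Multiset.count_singleton]
      simp only [f]
      rw [h1]
      congr 2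
      exact List.mergeSort_eq_self (· ≤ ·) hsort
  calc (S ^ n).card ≤ (Finset.univ.image f).card := Finset.card_le_card hsub
    _ ≤ (Finset.univ : Finset (Fin k → Fin (n + 1))).card := Finset.card_image_le
    _ = (n + 1) ^ k := by simp

/-- If the inequality failed for every `n`, the powers would grow at least like `(1 + ε) ^ n`,
against polynomial growth. -/
theorem exists_card_pow_succ_le {G : Type*} [Group G] [DecidableEq G] (S : Finset G)
    (hS : ∀ g, ∀ s ∈ S, g⁻¹ * s * g ∈ S) {ε : ℝ} (hε : 0 < ε) :
    ∃ n : ℕ, ((S ^ (n + 1)).card : ℝ) ≤ (1 + ε) * (S ^ n).card := by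
  by_contra! h
  have hgrow : ∀ n : ℕ, (1 + ε) ^ n ≤ ((S ^ n).card : ℝ) := by
    intro n
    induction n with
    | zero => simp
    | succ n ih =>
      rw [pow_succ']
      exact (mul_le_mul_of_nonneg_left ih (by positivity)).trans (h n).le
  -- The shift by one matches the base `n + 1` of the polynomial bound; the surplus factor `1 + ε`
  -- in the denominator is compensated by the threshold `1 / (1 + ε)`.
  have hlim := (tendsto_pow_const_div_const_pow_of_one_lt S.card
    (show 1 < 1 + ε by linarith)).comp (Filter.tendsto_add_atTop_nat 1)
  obtain ⟨n, hn⟩ := (hlim.eventually (gt_mem_nhds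
    (show (0 : ℝ) < 1 / (1 + ε) by positivity))).exists
  simp only [Function.comp_apply] at hn
  rw [div_lt_div_iff₀ (by positivity) (by positivity), one_mul, pow_succ] at hn
  have h1 : (1 + ε) ^ n ≤ ((n + 1 : ℕ) : ℝ) ^ S.card :=
    (hgrow n).trans (by exact_mod_cast card_pow_le_of_conj_invariant S hS n)
  have := lt_of_mul_lt_mul_right hn (by positivity)
  linarith

theorem conjugatesOf_conj {G : Type*} [Group G] (g s : G) :
    conjugatesOf (g⁻¹ * s * g) = conjugatesOf s :=
  (IsConj.conjugatesOf_eq (isConj_iff.2 ⟨g⁻¹, by simp⟩)).symm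

theorem conj_mem_fcCenter {Γ : Type u} [Group Γ] (g : Γ) {s : Γ} (hs : s ∈ fcCenter Γ) :
    g⁻¹ * s * g ∈ fcCenter Γ := by
  change (conjugatesOf _).Finite
  rw [conjugatesOf_conj]
  exact hs

open Classical in
/-- The FC-center is amenable: it has Følner sets. -/
theorem exists_folner {Γ : Type u} [Group Γ] (T : Finset (fcCenter Γ)) {ε : ℝ} (hε : 0 < ε) :
    ∃ F : Finset Γ, F.Nonempty ∧ (∀ t ∈ F, t ∈ fcCenter Γ) ∧
      ∀ s ∈ T, (((F.image fun t => (s : Γ) * t) \ F).card : ℝ) ≤ ε * F.card := by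
  -- The identity is inserted so that the powers of `S` are nested; then `s S ^ n \ S ^ n` lies in
  -- `S ^ (n + 1) \ S ^ n`.
  have hfin : (⋃ s ∈ insert 1 T, conjugatesOf (s : Γ)).Finite :=
    Set.Finite.biUnion (Finset.finite_toSet _) fun s _ => s.2
  set S : Finset Γ := hfin.toFinset with hSdef
  have hmem : ∀ x, x ∈ S ↔ ∃ s ∈ insert 1 T, x ∈ conjugatesOf (s : Γ) := by
    intro x; simp [hSdef]
  have hTS : ∀ s ∈ insert 1 T, (s : Γ) ∈ S := fun s hs => (hmem _).2 ⟨s, hs, mem_conjugatesOf_self⟩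
  have h1 : (1 : Γ) ∈ S := hTS 1 (Finset.mem_insert_self _ _)
  have hSN : ∀ x ∈ S, x ∈ fcCenter Γ := by
    intro x hx
    obtain ⟨s, -, hs⟩ := (hmem x).1 hx
    obtain ⟨c, rfl⟩ := isConj_iff.1 (show IsConj _ x from hs)
    simpa using conj_mem_fcCenter c⁻¹ s.2
  have hS : ∀ g, ∀ s ∈ S, g⁻¹ * s * g ∈ S := by
    intro g x hx
    obtain ⟨s, hs, hx⟩ := (hmem x).1 hx
    refine (hmem _).2 ⟨s, hs, ?_⟩
    exact (show IsConj _ x from hx).trans (isConj_iff.2 ⟨g⁻¹, by simp⟩)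
  obtain ⟨n, hn⟩ := exists_card_pow_succ_le S hS hε
  have hsub : S ^ n ⊆ S ^ (n + 1) := Finset.pow_subset_pow_right h1 (Nat.le_succ n)
  refine ⟨S ^ n, ⟨1, Finset.one_mem_pow h1⟩, ?_, ?_⟩
  · have : ∀ m : ℕ, ∀ t ∈ S ^ m, t ∈ fcCenter Γ := by
      intro m
      induction m with
      | zero => intro t ht; simp at ht; simp [ht]
      | succ m ih =>
        intro t ht
        rw [pow_succ, Finset.mem_mul] at ht
        obtain ⟨a, ha, b, hb, rfl⟩ := ht
        exact mul_mem (ih a ha) (hSN b hb)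
    exact this n
  · intro s hs
    have hsub' : ((S ^ n).image fun t => (s : Γ) * t) \ S ^ n ⊆ S ^ (n + 1) \ S ^ n := by
      refine Finset.sdiff_subset_sdiff ?_ le_rfl
      intro x hx
      obtain ⟨t, ht, rfl⟩ := Finset.mem_image.1 hx
      rw [pow_succ']
      exact Finset.mul_mem_mul (hTS s (Finset.mem_insert_of_mem hs)) ht
    have h2 := Finset.card_le_card hsub'
    rw [Finset.card_sdiff_of_subset hsub] at h2
    have h3 : ((((S ^ n).image fun t => (s : Γ) * t) \ S ^ n).card : ℝ) + (S ^ n).card ≤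
        (S ^ (n + 1)).card := by
      have := Finset.card_le_card hsub
      exact_mod_cast (by omega)
    linarith

open Classical in
/-- A Følner net of the FC-center. -/
theorem exists_folner_net (Γ : Type u) [Group Γ] :
    ∃ F : Finset (fcCenter Γ) × ℕ → Finset Γ, (∀ i, (F i).Nonempty) ∧
      (∀ i, ∀ t ∈ F i, t ∈ fcCenter Γ) ∧
      ∀ s ∈ fcCenter Γ, Filter.Tendsto
        (fun i => ((((F i).image fun t => s * t) \ F i).card : ℝ) / (F i).card)
        Filter.atTop (nhds 0) := by
  -- The first index is the finite set to be almost fixed, the second the tolerance `1 / (n + 1)`; a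
  -- given `s` is eventually in the first.
  choose F h1 h2 h3 using fun i : Finset (fcCenter Γ) × ℕ =>
    exists_folner i.1 (ε := 1 / ((i.2 : ℝ) + 1)) (by positivity)
  refine ⟨F, h1, h2, fun s hs => ?_⟩
  have hlim : Filter.Tendsto (fun i : Finset (fcCenter Γ) × ℕ => 1 / ((i.2 : ℝ) + 1))
      Filter.atTop (nhds 0) := by
    rw [← Filter.prod_atTop_atTop_eq]
    exact tendsto_one_div_add_atTop_nhds_zero_nat.comp Filter.tendsto_snd
  refine squeeze_zero' (Filter.Eventually.of_forall fun i => by positivity) ?_ hlim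
  filter_upwards [Filter.eventually_ge_atTop (({⟨s, hs⟩}, 0) : Finset (fcCenter Γ) × ℕ)] with i hi
  have hpos : (0 : ℝ) < (F i).card := by exact_mod_cast (h1 i).card_pos
  rw [div_le_iff₀ hpos]
  exact h3 i ⟨s, hs⟩ (hi.1 (Finset.mem_singleton_self _))

/-! ### Translations, coefficients and coordinates -/

section ConstOn

variable {Γ : Type u} {H : Type w} [NormedAddCommGroup H] [InnerProductSpace ℂ H]

open Classical in
/-- The inclusion of `H` into `ℓ²(Γ, H)` as the functions that are constant on `F` and vanish
outside `F`. -/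
def constOn (H : Type w) [NormedAddCommGroup H] [InnerProductSpace ℂ H] (F : Finset Γ) :
    H →L[ℂ] L2 Γ H :=
  ∑ t ∈ F, lp.singleContinuousLinearMap ℂ (fun _ : Γ => H) 2 t

open Classical in
theorem constOn_eq_sum (F : Finset Γ) (v : H) :
    constOn H F v = ∑ t ∈ F, lp.single 2 t v := by
  simp [constOn]

open Classical in
theorem constOn_apply (F : Finset Γ) (v : H) (t : Γ) :
    (constOn H F v : Γ → H) t = if t ∈ F then v else 0 := by
  rw [constOn_eq_sum, lp.coeFn_sum, Finset.sum_apply]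
  simp [Pi.single_apply]

theorem norm_constOn_le (F : Finset Γ) : ‖constOn H F‖ ≤ √F.card := by
  classical
  refine ContinuousLinearMap.opNorm_le_bound _ (by positivity) fun v => ?_
  have h := lp.norm_sum_single (p := 2) (by norm_num) (fun _ : Γ => v) F
  rw [← constOn_eq_sum] at h
  simp only [ENNReal.toReal_ofNat, Real.rpow_ofNat, Finset.sum_const, nsmul_eq_mul] at h
  refine abs_le_of_sq_le_sq' ?_ (by positivity) |>.2
  rw [h, mul_pow, Real.sq_sqrt (by positivity)]

theorem adjoint_constOn_apply [CompleteSpace H] (F : Finset Γ) (ζ : L2 Γ H) :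
    ContinuousLinearMap.adjoint (constOn H F) ζ = ∑ t ∈ F, (ζ : Γ → H) t := by
  classical
  refine ext_inner_left ℂ fun v => ?_
  rw [ContinuousLinearMap.adjoint_inner_right, constOn_eq_sum, sum_inner, inner_sum]
  exact Finset.sum_congr rfl fun t _ => lp.inner_single_left t v ζ

end ConstOn

section Operators

variable {Γ : Type u} [Group Γ] {H : Type w} [NormedAddCommGroup H] [InnerProductSpace ℂ H]

theorem translation_mul (s t : Γ) :
    translation H s * translation H t = translation H (s * t) := by
  ext ξ r
  simp [mul_assoc]

@[simp] theorem translation_one : translation H (1 : Γ) = 1 := by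
  ext ξ r
  simp

theorem norm_translation_apply (s : Γ) (ξ : L2 Γ H) : ‖translation H s ξ‖ = ‖ξ‖ :=
  norm_translate s ξ

theorem norm_translation_le (s : Γ) : ‖translation H s‖ ≤ 1 :=
  ContinuousLinearMap.opNorm_le_bound _ zero_le_one fun ξ => by
    rw [one_mul, norm_translation_apply]

theorem star_translation [CompleteSpace H] (s : Γ) :
    star (translation H s) = translation H s⁻¹ := by
  rw [ContinuousLinearMap.star_eq_adjoint, eq_comm, ContinuousLinearMap.eq_adjoint_iff]
  intro ξ η
  rw [lp.inner_eq_tsum, lp.inner_eq_tsum,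
    ← (Equiv.mulLeft s).tsum_eq fun t => inner ℂ ((ξ : Γ → H) t) ((translation H s η : Γ → H) t)]
  simp

open Classical in
theorem translation_comp_constOn (s : Γ) (F : Finset Γ) :
    translation H s ∘L constOn H F = constOn H (F.image fun t => s * t) := by
  ext v t
  simp only [ContinuousLinearMap.comp_apply, translation_apply, constOn_apply]
  congr 1
  simp

theorem card_image_mul_sdiff [DecidableEq Γ] (s : Γ) (F : Finset Γ) :
    (F \ F.image fun t => s * t).card = ((F.image fun t => s * t) \ F).card :=
  Finset.card_sdiff_comm (Finset.card_image_of_injective _ (mul_right_injective s)).symm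

-- Only the two halves of the symmetric difference of `sF` and `F` survive. They have equal size,
-- and an indicator has norm at most the square root of its cardinality.
open Classical in
theorem norm_translation_sub_one_comp_constOn_le (s : Γ) (F : Finset Γ) :
    ‖(translation H s - 1) ∘L constOn H F‖ ≤
      2 * √((F.image fun t => s * t) \ F).card := by
  have h : (translation H s - 1) ∘L constOn H F =
      constOn H ((F.image fun t => s * t) \ F) - constOn H (F \ F.image fun t => s * t) := by
    rw [ContinuousLinearMap.sub_comp, translation_comp_constOn]
    change _ - constOn H F = _
    unfold constOn
    exact Finset.sum_sdiff_sub_sum_sdiff.symm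
  rw [h, two_mul]
  have h2 := norm_constOn_le (H := H) (F \ F.image fun t => s * t)
  rw [card_image_mul_sdiff] at h2
  refine (norm_sub_le (constOn H ((F.image fun t => s * t) \ F))
    (constOn H (F \ F.image fun t => s * t))).trans ?_
  exact add_le_add (norm_constOn_le _) h2

/-- The average of the translations by the elements of `F`. -/
def average (H : Type w) [NormedAddCommGroup H] [InnerProductSpace ℂ H] (F : Finset Γ) :
    L2 Γ H →L[ℂ] L2 Γ H :=
  (F.card : ℂ)⁻¹ • ∑ t ∈ F, translation H t

theorem norm_sum_translation_le (F : Finset Γ) : ‖∑ t ∈ F, translation H t‖ ≤ F.card := by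
  refine (norm_sum_le F fun t => translation H t).trans ?_
  simpa using Finset.sum_le_card_nsmul F _ 1 fun t _ => norm_translation_le (H := H) t

theorem norm_average_le [CompleteSpace H] (F : Finset Γ) : ‖average H F‖ ≤ 1 := by
  rw [average, norm_smul, norm_inv, Complex.norm_natCast]
  exact (mul_le_mul_of_nonneg_left (norm_sum_translation_le F) (by positivity)).trans
    inv_mul_le_one

open Classical in
theorem norm_translation_sub_one_mul_average_le [CompleteSpace H] (s : Γ) (F : Finset Γ) :
    ‖(translation H s - 1) * average H F‖ ≤
      2 * (((F.image fun t => s * t) \ F).card / F.card : ℝ) := by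
  have h : (translation H s - 1) * ∑ t ∈ F, translation H t =
      ∑ t ∈ (F.image fun t => s * t) \ F, translation H t -
        ∑ t ∈ F \ F.image fun t => s * t, translation H t := by
    rw [Finset.sum_sdiff_sub_sum_sdiff, Finset.sum_image (mul_right_injective s).injOn, sub_mul,
      one_mul, Finset.mul_sum]
    simp_rw [translation_mul]
  rw [average, mul_smul_comm, norm_smul, norm_inv, Complex.norm_natCast, h, div_eq_inv_mul,
    mul_left_comm, two_mul]
  have h2 := norm_sum_translation_le (H := H) (F \ F.image fun t => s * t)
  rw [card_image_mul_sdiff] at h2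
  refine mul_le_mul_of_nonneg_left ?_ (by positivity)
  refine (norm_sub_le (∑ t ∈ (F.image fun t => s * t) \ F, translation H t)
    (∑ t ∈ F \ F.image fun t => s * t, translation H t)).trans ?_
  exact add_le_add (norm_sum_translation_le _) h2

variable [CompleteSpace H]

variable {A : Type v} [CStarAlgebra A] (α : Γ →* (A ≃⋆ₐ[ℂ] A)) (π : A →⋆ₐ[ℂ] (H →L[ℂ] H))

theorem coeffRep_mul (a b : A) : coeffRep α π (a * b) = coeffRep α π a * coeffRep α π b := by
  ext ξ t
  simp

@[simp] theorem coeffRep_one : coeffRep α π 1 = 1 := by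
  ext ξ t
  simp

theorem star_coeffRep (a : A) : star (coeffRep α π a) = coeffRep α π (star a) := by
  rw [ContinuousLinearMap.star_eq_adjoint, eq_comm, ContinuousLinearMap.eq_adjoint_iff]
  intro ξ η
  rw [lp.inner_eq_tsum, lp.inner_eq_tsum]
  refine tsum_congr fun t => ?_
  simp only [coeffRep_apply, map_star, ContinuousLinearMap.star_eq_adjoint]
  rw [ContinuousLinearMap.adjoint_inner_left]

theorem translation_mul_coeffRep (s : Γ) (a : A) :
    translation H s * coeffRep α π a = coeffRep α π (α s a) * translation H s := by
  ext ξ t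
  simp only [mul_apply_eq_comp, translation_apply, coeffRep_apply]
  rw [← StarAlgEquiv.mul_apply, ← map_mul]
  simp

-- The twists by `t⁻¹` in the coefficients disappear once an invariant functional is applied,
-- leaving a count of the `t` with `t, g⁻¹ t ∈ F`.
open Classical in
theorem compress_coeffRep_mul_translation (F : Finset Γ) (a : A) (g : Γ) :
    ContinuousLinearMap.adjoint (constOn H F) ∘L (coeffRep α π a * translation H g) ∘L
      constOn H F = ∑ t ∈ F, if g⁻¹ * t ∈ F then π (α t⁻¹ a) else 0 := by
  ext v
  simp only [ContinuousLinearMap.comp_apply, adjoint_constOn_apply, mul_apply_eq_comp,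
    coeffRep_apply, translation_apply, constOn_apply, sum_apply]
  refine Finset.sum_congr rfl fun t _ => ?_
  split_ifs <;> simp

end Operators

/-! ### Closed spans in a C*-algebra -/

section Abstract

variable {E : Type*} [CStarAlgebra E]

theorem closure_span_subset {S : Set E} {P : Submodule ℂ E} (hP : IsClosed (P : Set E))
    (h : S ⊆ P) : closure (Submodule.span ℂ S : Set E) ⊆ P :=
  closure_minimal (Submodule.span_le.2 h) hP

theorem subset_closure_span (S : Set E) : S ⊆ closure (Submodule.span ℂ S : Set E) :=
  Submodule.subset_span.trans subset_closure

theorem mul_mem_of_mem_closure_span {S T : Set E} {P : Submodule ℂ E}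
    (hP : IsClosed (P : Set E)) (h : ∀ a ∈ S, ∀ b ∈ T, a * b ∈ P) {x y : E}
    (hx : x ∈ closure (Submodule.span ℂ S : Set E))
    (hy : y ∈ closure (Submodule.span ℂ T : Set E)) : x * y ∈ P := by
  have h1 : ∀ b ∈ T, x * b ∈ P := fun b hb =>
    closure_span_subset (P := P.comap (LinearMap.mulRight ℂ b))
      (hP.preimage (continuous_mul_const b)) (fun a ha => h a ha b hb) hx
  exact closure_span_subset (P := P.comap (LinearMap.mulLeft ℂ x))
    (hP.preimage (continuous_const_mul x)) h1 hy

theorem star_mem_of_mem_closure_span {S : Set E} {P : Submodule ℂ E}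
    (hP : IsClosed (P : Set E)) (h : ∀ a ∈ S, star a ∈ P) {x : E}
    (hx : x ∈ closure (Submodule.span ℂ S : Set E)) : star x ∈ P :=
  closure_span_subset (P := P.comap (starLinearEquiv ℂ (A := E)).toLinearMap)
    (hP.preimage continuous_star) h hx

/-- The span of a self-adjoint multiplicative set containing `1` is already a *-algebra. This
reduces claims about the generated C*-algebras to monomials. -/
theorem adjoin_subset_span {s M : Set E} (hs : s ⊆ M) (hone : 1 ∈ M)
    (hmul : ∀ a ∈ M, ∀ b ∈ M, a * b ∈ M) (hstar : ∀ a ∈ M, star a ∈ M) :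
    (StarAlgebra.adjoin ℂ s : Set E) ⊆ Submodule.span ℂ M := by
  intro x hx
  induction hx using StarAlgebra.adjoin_induction with
  | mem x hx => exact Submodule.subset_span (hs hx)
  | algebraMap r =>
    rw [Algebra.algebraMap_eq_smul_one]
    exact Submodule.smul_mem _ _ (Submodule.subset_span hone)
  | add x y _ _ hx hy => exact Submodule.add_mem _ hx hy
  | mul x y _ _ hx hy =>
    have h := Submodule.mul_mem_mul hx hy
    rw [Submodule.span_mul_span] at h
    refine Submodule.span_mono ?_ h
    rintro _ ⟨a, ha, b, hb, rfl⟩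
    exact hmul a ha b hb
  | star x _ hx =>
    refine Submodule.span_induction (p := fun x _ => star x ∈ Submodule.span ℂ M)
      (fun a ha => Submodule.subset_span (hstar a ha)) (by simp)
      (fun a b _ _ ha hb => by rw [star_add]; exact Submodule.add_mem _ ha hb)
      (fun c a _ ha => by rw [star_smul]; exact Submodule.smul_mem _ _ ha) hx

/-- The sum of two closed subspaces is closed if the summands of a sum can be chosen bounded in
terms of the sum. -/
theorem isClosed_add_of_bounded {P K : Submodule ℂ E} (hP : IsClosed (P : Set E))
    (hK : IsClosed (K : Set E)) {M : ℝ} (hM : 0 ≤ M)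
    (h : ∀ c ∈ P, ∀ k ∈ K, ∀ ε > 0, ∃ c' ∈ P, ∃ k' ∈ K, c' + k' = c + k ∧
      ‖c'‖ ≤ M * ‖c + k‖ + ε) : IsClosed ((P : Set E) + (K : Set E)) := by
  have : CompleteSpace P := hP.completeSpace_coe
  have : CompleteSpace K := hK.completeSpace_coe
  let f : NormedAddGroupHom (P × K) E :=
    AddMonoidHom.mkNormedAddGroupHom
      (AddMonoidHom.coprod P.subtype.toAddMonoidHom K.subtype.toAddMonoidHom) 2 fun x => by
        change ‖(x.1 : E) + x.2‖ ≤ _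
        have h1 : ‖(x.1 : E)‖ ≤ ‖x‖ := norm_fst_le x
        have h2 : ‖(x.2 : E)‖ ≤ ‖x‖ := norm_snd_le x
        linarith [norm_add_le (x.1 : E) x.2]
  have hf : ∀ x, f x = (x.1 : E) + x.2 := fun _ => rfl
  -- Addition `P × K → E` hits its range with norm control; by completeness of the source, this
  -- control passes to the closure of the range.
  have hsurj : f.SurjectiveOnWith (P ⊔ K).toAddSubgroup (M + 2) := by
    intro x hx
    obtain ⟨c, hc, k, hk, rfl⟩ := Submodule.mem_sup.1 hx
    rcases eq_or_ne (c + k) 0 with h0 | h0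
    · exact ⟨0, by rw [map_zero, h0], by simp [h0]⟩
    -- With error `‖c + k‖`, the first summand is bounded by `(M + 1) ‖c + k‖` and hence the second
    -- by `(M + 2) ‖c + k‖`.
    obtain ⟨c', hc', k', hk', he, hn⟩ := h c hc k hk ‖c + k‖ (norm_pos_iff.2 h0)
    refine ⟨(⟨c', hc'⟩, ⟨k', hk'⟩), he, ?_⟩
    have hk2 : k' = (c + k) - c' := by rw [← he]; abel
    have hk3 : ‖k'‖ ≤ ‖c + k‖ + ‖c'‖ := by rw [hk2]; exact norm_sub_le _ _
    rw [Prod.norm_def]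
    refine max_le ?_ ?_
    · change ‖c'‖ ≤ _
      linarith [norm_nonneg (c + k)]
    · change ‖k'‖ ≤ _
      linarith
  have hcl := controlled_closure_of_complete (by positivity) one_pos hsurj
  rw [← Submodule.coe_sup]
  refine isClosed_of_closure_subset fun x hx => ?_
  obtain ⟨y, rfl, -⟩ := hcl x hx
  rw [hf]
  exact Submodule.add_mem_sup y.1.2 y.2.2

/-! ### The algebra `C + K` for a sandwich `K` -/

/-- The closed span of all `η x η'` with `η, η' ∈ I` and `x ∈ X`. -/
def sandwichSpan (I : Submodule ℂ E) (X : StarSubalgebra ℂ E) : Submodule ℂ E :=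
  (Submodule.span ℂ {T | ∃ η ∈ I, ∃ x ∈ X, ∃ η' ∈ I, T = η * x * η'}).topologicalClosure

theorem isClosed_sandwichSpan (I : Submodule ℂ E) (X : StarSubalgebra ℂ E) :
    IsClosed (sandwichSpan I X : Set E) :=
  Submodule.isClosed_topologicalClosure _

theorem mul_mul_mem_sandwichSpan {I : Submodule ℂ E} {X : StarSubalgebra ℂ E} {η x η' : E}
    (h : η ∈ I) (hx : x ∈ X) (h' : η' ∈ I) : η * x * η' ∈ sandwichSpan I X :=
  subset_closure_span _ ⟨η, h, x, hx, η', h', rfl⟩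

theorem sandwichSpan_subset {I : Submodule ℂ E} {X : StarSubalgebra ℂ E}
    (hX : IsClosed (X : Set E)) (hI : ∀ η ∈ I, η ∈ X) {k : E} (hk : k ∈ sandwichSpan I X) :
    k ∈ X := by
  refine closure_span_subset (P := X.toSubalgebra.toSubmodule) hX ?_ hk
  rintro _ ⟨η, h, x, hx, η', h', rfl⟩
  exact X.mul_mem (X.mul_mem (hI η h) hx) (hI η' h')

theorem star_mem_sandwichSpan {I : Submodule ℂ E} {X : StarSubalgebra ℂ E}
    (hI : ∀ η ∈ I, star η ∈ I) {k : E} (hk : k ∈ sandwichSpan I X) :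
    star k ∈ sandwichSpan I X := by
  refine star_mem_of_mem_closure_span (isClosed_sandwichSpan I X) ?_ hk
  rintro _ ⟨η, h, x, hx, η', h', rfl⟩
  rw [star_mul, star_mul, ← mul_assoc]
  exact mul_mul_mem_sandwichSpan (hI _ h') (star_mem hx) (hI _ h)

theorem mul_mem_sandwichSpan {I : Submodule ℂ E} {X : StarSubalgebra ℂ E} {c k : E}
    (hc : ∀ η ∈ I, c * η ∈ I) (hk : k ∈ sandwichSpan I X) : c * k ∈ sandwichSpan I X := by
  refine closure_span_subset (P := (sandwichSpan I X).comap (LinearMap.mulLeft ℂ c))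
    ((isClosed_sandwichSpan I X).preimage (continuous_const_mul c)) ?_ hk
  rintro _ ⟨η, h, x, hx, η', h', rfl⟩
  change c * (η * x * η') ∈ sandwichSpan I X
  rw [← mul_assoc, ← mul_assoc]
  exact mul_mul_mem_sandwichSpan (hc η h) hx h'

theorem sandwichSpan_mul_mem {I : Submodule ℂ E} {X : StarSubalgebra ℂ E}
    (hX : ∀ η ∈ I, η ∈ X) {k l : E} (hk : k ∈ sandwichSpan I X) (hl : l ∈ sandwichSpan I X) :
    k * l ∈ sandwichSpan I X := by
  refine mul_mem_of_mem_closure_span (isClosed_sandwichSpan I X) ?_ hk hl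
  rintro _ ⟨η, h, x, hx, η', h', rfl⟩ _ ⟨θ, g, y, hy, θ', g', rfl⟩
  have : η * x * η' * (θ * y * θ') = η * (x * η' * θ * y) * θ' := by noncomm_ring
  rw [this]
  exact mul_mul_mem_sandwichSpan h (mul_mem (mul_mem (mul_mem hx (hX _ h')) (hX _ g)) hy) g'

/-- The C*-algebra `C + K`, for a C*-subalgebra `C` and the sandwich `K` of an ideal `I` of `C`. -/
def addSandwich (C X : StarSubalgebra ℂ E) (I : Submodule ℂ E) (hCX : C ≤ X)
    (hIC : ∀ η ∈ I, η ∈ C) (hCI : ∀ c ∈ C, ∀ η ∈ I, c * η ∈ I) (hI : ∀ η ∈ I, star η ∈ I) :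
    StarSubalgebra ℂ E where
  carrier := (C : Set E) + (sandwichSpan I X : Set E)
  mul_mem' := by
    rintro _ _ ⟨c, hc, k, hk, rfl⟩ ⟨d, hd, l, hl, rfl⟩
    have hkd : k * d ∈ sandwichSpan I X := by
      rw [← star_star (k * d), star_mul]
      exact star_mem_sandwichSpan hI
        (mul_mem_sandwichSpan (hCI _ (star_mem hd)) (star_mem_sandwichSpan hI hk))
    refine ⟨c * d, mul_mem hc hd, c * l + k * d + k * l, ?_, by
      simp only [add_mul, mul_add]; abel⟩
    exact add_mem (add_mem (mul_mem_sandwichSpan (hCI c hc) hl) hkd)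
      (sandwichSpan_mul_mem (fun η h => hCX (hIC η h)) hk hl)
  add_mem' := by
    rintro _ _ ⟨c, hc, k, hk, rfl⟩ ⟨d, hd, l, hl, rfl⟩
    exact ⟨c + d, add_mem hc hd, k + l, add_mem hk hl, by simp only; abel⟩
  algebraMap_mem' r := ⟨algebraMap ℂ E r, algebraMap_mem C r, 0, zero_mem _, add_zero _⟩
  star_mem' := by
    rintro _ ⟨c, hc, k, hk, rfl⟩
    exact ⟨star c, star_mem hc, star k, star_mem_sandwichSpan hI hk, (star_add c k).symm⟩

section

variable {C X : StarSubalgebra ℂ E} {I : Submodule ℂ E} {hCX : C ≤ X}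
  {hIC : ∀ η ∈ I, η ∈ C} {hCI : ∀ c ∈ C, ∀ η ∈ I, c * η ∈ I} {hI : ∀ η ∈ I, star η ∈ I}

theorem le_addSandwich : C ≤ addSandwich C X I hCX hIC hCI hI :=
  fun c hc => ⟨c, hc, 0, zero_mem _, add_zero c⟩

theorem sandwichSpan_subset_addSandwich {k : E} (hk : k ∈ sandwichSpan I X) :
    k ∈ addSandwich C X I hCX hIC hCI hI :=
  ⟨0, zero_mem C, k, hk, zero_add k⟩

theorem addSandwich_le (hX : IsClosed (X : Set E)) : addSandwich C X I hCX hIC hCI hI ≤ X := by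
  rintro _ ⟨c, hc, k, hk, rfl⟩
  exact add_mem (hCX hc) (sandwichSpan_subset hX (fun η h => hCX (hIC η h)) hk)

/-- `K` absorbs multiplication by the whole algebra, not only by `C`. This is later applied to
`σ(d*) k`. -/
theorem addSandwich_mul_mem {b k : E} (hb : b ∈ addSandwich C X I hCX hIC hCI hI)
    (hk : k ∈ sandwichSpan I X) : b * k ∈ sandwichSpan I X := by
  obtain ⟨c, hc, l, hl, rfl⟩ := hb
  simp only [add_mul]
  exact add_mem (mul_mem_sandwichSpan (hCI c hc) hk)
    (sandwichSpan_mul_mem (fun η h => hCX (hIC η h)) hl hk)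

end

theorem tendsto_zero_of_mem_closure_span {ι G : Type*} [NormedAddCommGroup G] [NormedSpace ℂ G]
    {l : Filter ι} {L : ι → E →ₗ[ℂ] G} {M : ℝ} (hL : ∀ i x, ‖L i x‖ ≤ M * ‖x‖) {S : Set E}
    (h : ∀ x ∈ S, Filter.Tendsto (fun i => L i x) l (nhds 0)) {x : E}
    (hx : x ∈ closure (Submodule.span ℂ S : Set E)) :
    Filter.Tendsto (fun i => L i x) l (nhds 0) := by
  have hspan : ∀ y ∈ Submodule.span ℂ S, Filter.Tendsto (fun i => L i y) l (nhds 0) := by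
    intro y hy
    induction hy using Submodule.span_induction with
    | mem y hy => exact h y hy
    | zero => simpa using tendsto_const_nhds
    | add y z _ _ hy hz => simpa using hy.add hz
    | smul c y _ hy => simpa using hy.const_smul c
  rw [Metric.tendsto_nhds]
  intro ε hε
  -- The constant `|M| + 1` is positive whatever the sign of `M`.
  obtain ⟨y, hy, hxy⟩ := Metric.mem_closure_iff.1 hx (ε / (2 * (|M| + 1))) (by positivity)
  filter_upwards [Metric.tendsto_nhds.1 (hspan y hy) (ε / 2) (by positivity)] with i hi
  rw [dist_zero_right] at hi ⊢
  rw [dist_eq_norm, lt_div_iff₀ (by positivity)] at hxy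
  have h1 : ‖L i (x - y)‖ ≤ (|M| + 1) * ‖x - y‖ :=
    (hL i _).trans (mul_le_mul_of_nonneg_right (by linarith [le_abs_self M]) (norm_nonneg _))
  have h2 : L i x = L i (x - y) + L i y := by rw [← map_add, sub_add_cancel]
  rw [h2]
  linarith [norm_add_le (L i (x - y)) (L i y)]

/-- Operators of norm at most one that asymptotically annihilate `I` from the left do so with the
sandwich of `I`. -/
theorem tendsto_mul_sandwichSpan {ι : Type*} {l : Filter ι} {I : Submodule ℂ E}
    {X : StarSubalgebra ℂ E} {f : ι → E} (hf : ∀ i, ‖f i‖ ≤ 1)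
    (h : ∀ η ∈ I, Filter.Tendsto (fun i => f i * η) l (nhds 0)) {k : E}
    (hk : k ∈ sandwichSpan I X) : Filter.Tendsto (fun i => f i * k) l (nhds 0) := by
  refine tendsto_zero_of_mem_closure_span (L := fun i => LinearMap.mulLeft ℂ (f i)) (M := 1)
    (fun i x => norm_mul_le_of_le (hf i) le_rfl) ?_ hk
  rintro _ ⟨η, hη, x, -, η', -, rfl⟩
  have := (h η hη).mul_const (x * η')
  simpa [mul_assoc] using this

/-- With `e = 1 - f`, moving `c e²` from `C` to `K` leaves `c (1 - e²) = c f (2 - f)`, which is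
close to `(c + k) f (2 - f)` because `k f` is small. The square is needed because an element of the
sandwich has a factor from `I` on each side. -/
theorem isClosed_addSandwich {ι : Type*} {l : Filter ι} [l.NeBot] {C X : StarSubalgebra ℂ E}
    {I : Submodule ℂ E} {hCX : C ≤ X} {hIC : ∀ η ∈ I, η ∈ C}
    {hCI : ∀ c ∈ C, ∀ η ∈ I, c * η ∈ I} {hI : ∀ η ∈ I, star η ∈ I}
    (hC : IsClosed (C : Set E)) {f : ι → E} (hf : ∀ i, ‖f i‖ ≤ 1) (hfI : ∀ i, 1 - f i ∈ I)
    (hfη : ∀ η ∈ I, Filter.Tendsto (fun i => star (f i) * η) l (nhds 0)) :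
    IsClosed (addSandwich C X I hCX hIC hCI hI : Set E) := by
  refine isClosed_add_of_bounded (P := C.toSubalgebra.toSubmodule) hC
    (isClosed_sandwichSpan I X) (M := 3) (by norm_num) ?_
  intro c hc k hk ε hε
  have hlim : Filter.Tendsto (fun i => k * f i) l (nhds 0) := by
    -- Annihilation from the right is obtained by taking adjoints: `k f = (f* k*)*`.
    have h1 := tendsto_mul_sandwichSpan (f := fun i => star (f i)) (by simpa using hf) hfη
      (star_mem_sandwichSpan hI hk)
    simpa using h1.star
  obtain ⟨i, hi⟩ := ((tendsto_zero_iff_norm_tendsto_zero.1 hlim).eventually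
    (gt_mem_nhds (show 0 < ε / 3 by positivity))).exists
  set e := 1 - f i with he
  have heI : e ∈ I := hfI i
  have hceK : c * (e * e) ∈ sandwichSpan I X := by
    have := mul_mul_mem_sandwichSpan (hCI c hc e heI) (one_mem X) heI
    rwa [mul_one, mul_assoc] at this
  have heC : e * e ∈ C := mul_mem (hIC e heI) (hIC e heI)
  refine ⟨c - c * (e * e), C.sub_mem hc (C.mul_mem hc heC), k + c * (e * e),
    add_mem hk hceK, by abel, ?_⟩
  have h2 : c - c * (e * e) = ((c + k) * f i) * (2 - f i) - (k * f i) * (2 - f i) := by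
    rw [he]; noncomm_ring
  have h3 : ‖2 - f i‖ ≤ 3 := by
    have h4 : (2 - f i : E) = 1 + (1 - f i) := by norm_num [← add_sub_assoc, one_add_one_eq_two]
    have h5 : ‖(1 : E)‖ ≤ 1 := by
      rcases subsingleton_or_nontrivial E with h | h
      · rw [Subsingleton.elim (1 : E) 0]; simp
      · exact CStarRing.norm_one.le
    rw [h4]
    linarith [norm_add_le 1 (1 - f i), norm_sub_le 1 (f i), hf i]
  rw [h2]
  have h6 : ‖(c + k) * f i * (2 - f i)‖ ≤ ‖c + k‖ * 1 * 3 :=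
    norm_mul_le_of_le (norm_mul_le_of_le le_rfl (hf i)) h3
  have h7 : ‖k * f i * (2 - f i)‖ ≤ ε / 3 * 3 := norm_mul_le_of_le hi.le h3
  linarith [norm_sub_le ((c + k) * f i * (2 - f i)) (k * f i * (2 - f i))]

end Abstract

/-! ### The intermediate algebra -/

section AugmentationIdeal

variable {Γ : Type u} [Group Γ] {H : Type w} [NormedAddCommGroup H] [InnerProductSpace ℂ H]

/-- As the coefficients sum to zero, each `λ_s` may be replaced by `λ_s - 1`. -/
theorem augmentationIdeal_subset :
    augmentationIdeal H (fcCenter Γ) ⊆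
      closure (Submodule.span ℂ {T : L2 Γ H →L[ℂ] L2 Γ H | ∃ s ∈ fcCenter Γ,
        T = translation H s - 1}) := by
  refine closure_mono ?_
  rintro _ ⟨c, hc, rfl⟩
  have h : (c.sum fun s z => z • translation H (s : Γ)) =
      c.sum fun s z => z • (translation H (s : Γ) - 1) := by
    have h0 : (c.sum fun _ z => z • (1 : L2 Γ H →L[ℂ] L2 Γ H)) = 0 := by
      rw [Finsupp.sum, ← Finset.sum_smul]
      exact (congrArg (· • (1 : L2 Γ H →L[ℂ] L2 Γ H)) hc).trans (zero_smul _ _)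
    simp only [smul_sub, Finsupp.sum_sub]
    rw [h0, sub_zero]
  rw [h]
  exact Submodule.sum_mem _ fun s _ =>
    Submodule.smul_mem _ _ (Submodule.subset_span ⟨s, s.2, rfl⟩)

theorem translation_sub_one_mem_augmentationIdeal {s : Γ} (hs : s ∈ fcCenter Γ) :
    translation H s - 1 ∈ augmentationIdeal H (fcCenter Γ) := by
  classical
  refine subset_closure ⟨Finsupp.single ⟨s, hs⟩ 1 - Finsupp.single 1 1, ?_, ?_⟩
  · rw [Finsupp.sum_sub_index (fun _ _ _ => rfl)]
    simp
  · rw [Finsupp.sum_sub_index (fun _ _ _ => sub_smul _ _ _)]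
    simp

end AugmentationIdeal

section Intermediate

variable {Γ : Type u} [Group Γ] {H : Type w} [NormedAddCommGroup H] [InnerProductSpace ℂ H]
  [CompleteSpace H] {A : Type v} [CStarAlgebra A] (α : Γ →* (A ≃⋆ₐ[ℂ] A))
  (π : A →⋆ₐ[ℂ] (H →L[ℂ] H))

theorem reducedGroupAlgebra_top_subset :
    (reducedGroupAlgebra H (⊤ : Subgroup Γ) : Set (L2 Γ H →L[ℂ] L2 Γ H)) ⊆
      closure (Submodule.span ℂ (Set.range (translation (Γ := Γ) H))) := by
  rw [reducedGroupAlgebra, StarSubalgebra.topologicalClosure_coe]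
  refine closure_mono (adjoin_subset_span ?_ ⟨1, translation_one⟩ ?_ ?_)
  · rintro _ ⟨s, -, rfl⟩
    exact ⟨s, rfl⟩
  · rintro _ ⟨s, rfl⟩ _ ⟨t, rfl⟩
    exact ⟨s * t, (translation_mul s t).symm⟩
  · rintro _ ⟨s, rfl⟩
    exact ⟨s⁻¹, (star_translation s).symm⟩

theorem isClosed_reducedGroupAlgebra (N : Subgroup Γ) :
    IsClosed (reducedGroupAlgebra H N : Set (L2 Γ H →L[ℂ] L2 Γ H)) :=
  StarSubalgebra.isClosed_topologicalClosure _

theorem isClosed_crossedProductOf (D : StarSubalgebra ℂ A) :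
    IsClosed (crossedProductOf α π D : Set (L2 Γ H →L[ℂ] L2 Γ H)) :=
  StarSubalgebra.isClosed_topologicalClosure _

theorem translation_mem_reducedGroupAlgebra (s : Γ) :
    translation H s ∈ reducedGroupAlgebra H (⊤ : Subgroup Γ) :=
  StarSubalgebra.le_topologicalClosure _ (StarAlgebra.subset_adjoin ℂ _ ⟨s, trivial, rfl⟩)

theorem coeffRep_mem_crossedProductOf {D : StarSubalgebra ℂ A} {d : A} (hd : d ∈ D) :
    coeffRep α π d ∈ crossedProductOf α π D :=
  StarSubalgebra.le_topologicalClosure _ (StarAlgebra.subset_adjoin ℂ _ (Or.inl ⟨d, hd, rfl⟩))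

theorem reducedGroupAlgebra_le_crossedProductOf (D : StarSubalgebra ℂ A) :
    reducedGroupAlgebra H (⊤ : Subgroup Γ) ≤ crossedProductOf α π D := by
  refine StarSubalgebra.topologicalClosure_mono (StarAlgebra.adjoin_mono ?_)
  rintro _ ⟨s, -, rfl⟩
  exact Or.inr ⟨s, rfl⟩

/-- The covariance relation `λ_g σ(d) = σ(g d) λ_g` and the invariance of `D` make the monomials
`σ(d) λ_g` closed under products and adjoints. -/
theorem crossedProductOf_subset {D : StarSubalgebra ℂ A} (hD : ∀ (g : Γ), ∀ d ∈ D, α g d ∈ D) :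
    (crossedProductOf α π D : Set (L2 Γ H →L[ℂ] L2 Γ H)) ⊆
      closure (Submodule.span ℂ {T | ∃ d ∈ D, ∃ g, T = coeffRep α π d * translation H g}) := by
  rw [crossedProductOf, StarSubalgebra.topologicalClosure_coe]
  refine closure_mono (adjoin_subset_span ?_ ⟨1, one_mem D, 1, by simp⟩ ?_ ?_)
  · rintro _ (⟨d, hd, rfl⟩ | ⟨s, rfl⟩)
    · exact ⟨d, hd, 1, by simp⟩
    · exact ⟨1, one_mem D, s, by simp⟩
  · rintro _ ⟨d, hd, g, rfl⟩ _ ⟨d', hd', g', rfl⟩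
    refine ⟨d * α g d', mul_mem hd (hD g d' hd'), g * g', ?_⟩
    rw [mul_assoc, ← mul_assoc (translation H g), translation_mul_coeffRep, coeffRep_mul,
      ← translation_mul]
    simp only [mul_assoc]
  · rintro _ ⟨d, hd, g, rfl⟩
    refine ⟨α g⁻¹ (star d), hD _ _ (star_mem hd), g⁻¹, ?_⟩
    rw [star_mul, star_translation, star_coeffRep, translation_mul_coeffRep]

/-! ### The ideal of the FC-center and its sandwich -/

/-- The closed ideal of `C*_r(Γ)` generated by the `λ_s - 1`, with `s` in the FC-center. -/
def fcIdeal (Γ : Type u) [Group Γ] (H : Type w) [NormedAddCommGroup H] [InnerProductSpace ℂ H]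
    [CompleteSpace H] : Submodule ℂ (L2 Γ H →L[ℂ] L2 Γ H) :=
  (Submodule.span ℂ {T | ∃ s ∈ fcCenter Γ, ∃ g : Γ,
    T = (translation H s - 1) * translation H g}).topologicalClosure

theorem isClosed_fcIdeal : IsClosed (fcIdeal Γ H : Set (L2 Γ H →L[ℂ] L2 Γ H)) :=
  Submodule.isClosed_topologicalClosure _

theorem mul_mem_fcIdeal {s : Γ} (hs : s ∈ fcCenter Γ) (g : Γ) :
    (translation H s - 1) * translation H g ∈ fcIdeal Γ H :=
  subset_closure_span _ ⟨s, hs, g, rfl⟩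

theorem translation_sub_one_mem_fcIdeal {s : Γ} (hs : s ∈ fcCenter Γ) :
    translation H s - 1 ∈ fcIdeal Γ H := by
  simpa using mul_mem_fcIdeal (H := H) hs 1

/-- This trades the nested closures in the definition of `I` for the span of explicit products `(λ_s
- 1) λ_g`. -/
theorem coe_fcIdeal :
    (fcIdeal Γ H : Set (L2 Γ H →L[ℂ] L2 Γ H)) =
      inducedIdeal (augmentationIdeal H (fcCenter Γ)) := by
  refine Set.Subset.antisymm (closure_mono (Submodule.span_mono ?_))
    (closure_span_subset isClosed_fcIdeal ?_)
  · rintro _ ⟨s, hs, g, rfl⟩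
    exact ⟨_, translation_sub_one_mem_augmentationIdeal hs, _,
      translation_mem_reducedGroupAlgebra g, rfl⟩
  · rintro _ ⟨η, hη, a, ha, rfl⟩
    refine mul_mem_of_mem_closure_span isClosed_fcIdeal ?_ (augmentationIdeal_subset hη)
      (reducedGroupAlgebra_top_subset ha)
    rintro _ ⟨s, hs, rfl⟩ _ ⟨g, rfl⟩
    exact mul_mem_fcIdeal hs g

/-- Normality of the FC-center allows `λ_g⁻¹` to be moved to the right of `λ_s⁻¹ - 1`, at the cost
of conjugating `s⁻¹`. -/
theorem star_mem_fcIdeal {η : L2 Γ H →L[ℂ] L2 Γ H} (hη : η ∈ fcIdeal Γ H) :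
    star η ∈ fcIdeal Γ H := by
  refine star_mem_of_mem_closure_span isClosed_fcIdeal ?_ hη
  rintro _ ⟨s, hs, g, rfl⟩
  have h : star ((translation H s - 1) * translation H g) =
      (translation H (g⁻¹ * s⁻¹ * g) - 1) * translation H g⁻¹ := by
    rw [star_mul, star_sub, star_translation, star_translation, star_one, mul_sub, sub_mul,
      translation_mul, translation_mul]
    simp
  rw [h]
  exact mul_mem_fcIdeal (conj_mem_fcCenter g (inv_mem hs)) _

theorem mul_mem_fcIdeal_of_mem {c η : L2 Γ H →L[ℂ] L2 Γ H}
    (hc : c ∈ reducedGroupAlgebra H (⊤ : Subgroup Γ)) (hη : η ∈ fcIdeal Γ H) :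
    c * η ∈ fcIdeal Γ H := by
  refine mul_mem_of_mem_closure_span isClosed_fcIdeal ?_ (reducedGroupAlgebra_top_subset hc) hη
  rintro _ ⟨h, rfl⟩ _ ⟨s, hs, g, rfl⟩
  have he : translation H h * ((translation H s - 1) * translation H g) =
      (translation H (h * s * h⁻¹) - 1) * translation H (h * g) := by
    simp only [sub_mul, mul_sub, translation_mul, one_mul]
    simp [mul_assoc]
  rw [he]
  exact mul_mem_fcIdeal (by simpa using conj_mem_fcCenter h⁻¹ hs) _

theorem mem_reducedGroupAlgebra_of_mem_fcIdeal {η : L2 Γ H →L[ℂ] L2 Γ H}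
    (hη : η ∈ fcIdeal Γ H) : η ∈ reducedGroupAlgebra H (⊤ : Subgroup Γ) := by
  refine closure_span_subset
    (P := (reducedGroupAlgebra H (⊤ : Subgroup Γ)).toSubalgebra.toSubmodule)
    (isClosed_reducedGroupAlgebra _) ?_ hη
  rintro _ ⟨s, -, g, rfl⟩
  exact mul_mem (S := StarSubalgebra ℂ (L2 Γ H →L[ℂ] L2 Γ H))
    (sub_mem (translation_mem_reducedGroupAlgebra s) (one_mem _))
    (translation_mem_reducedGroupAlgebra g)

/-- The C*-algebra `C*_r(Γ) + closure (A_I)`. -/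
def augmentationAlgebra : StarSubalgebra ℂ (L2 Γ H →L[ℂ] L2 Γ H) :=
  addSandwich (reducedGroupAlgebra H ⊤) (crossedProduct α π) (fcIdeal Γ H)
    (reducedGroupAlgebra_le_crossedProductOf α π ⊤)
    (fun _ => mem_reducedGroupAlgebra_of_mem_fcIdeal)
    (fun _ hc _ => mul_mem_fcIdeal_of_mem hc) (fun _ => star_mem_fcIdeal)

theorem coe_augmentationAlgebra :
    (augmentationAlgebra α π : Set (L2 Γ H →L[ℂ] L2 Γ H)) = augmentationSum α π := by
  rw [augmentationSum, ← coe_fcIdeal]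
  rfl

theorem one_sub_average_mem_fcIdeal {F : Finset Γ} (hF : F.Nonempty)
    (hFN : ∀ t ∈ F, t ∈ fcCenter Γ) : 1 - average H F ∈ fcIdeal Γ H := by
  have h : 1 - average H F = -((F.card : ℂ)⁻¹ • ∑ t ∈ F, (translation H t - 1)) := by
    have hc : (F.card : ℂ) ≠ 0 := by exact_mod_cast hF.card_pos.ne'
    rw [Finset.sum_sub_distrib, smul_sub, average, Finset.sum_const,
      ← Nat.cast_smul_eq_nsmul ℂ, inv_smul_smul₀ hc, neg_sub]
  rw [h]
  exact neg_mem (Submodule.smul_mem _ _ (sum_mem fun t ht =>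
    translation_sub_one_mem_fcIdeal (hFN t ht)))

/-- Operators that are bounded and asymptotically invariant under the FC-center asymptotically
annihilate the ideal of the FC-center. -/
theorem tendsto_adjoint_comp_fcIdeal {G : Type*} [NormedAddCommGroup G] [InnerProductSpace ℂ G]
    [CompleteSpace G] {ι : Type*} {l : Filter ι} {U : ι → G →L[ℂ] L2 Γ H} (hU : ∀ i, ‖U i‖ ≤ 1)
    (h : ∀ s ∈ fcCenter Γ, Filter.Tendsto (fun i => ‖(translation H s - 1) ∘L U i‖) l (nhds 0))
    {η : L2 Γ H →L[ℂ] L2 Γ H} (hη : η ∈ fcIdeal Γ H) :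
    Filter.Tendsto (fun i => ‖ContinuousLinearMap.adjoint (U i) ∘L η‖) l (nhds 0) := by
  refine tendsto_zero_iff_norm_tendsto_zero.1 <| tendsto_zero_of_mem_closure_span
    (L := fun i => (ContinuousLinearMap.compL ℂ (L2 Γ H) (L2 Γ H) G
      (ContinuousLinearMap.adjoint (U i))).toLinearMap) (M := 1) (fun i x => ?_) ?_ hη
  · refine (ContinuousLinearMap.opNorm_comp_le _ _).trans ?_
    gcongr
    rw [LinearIsometryEquiv.norm_map]
    exact hU i
  · rintro _ ⟨s, hs, g, rfl⟩
    -- Taking adjoints turns `U* (λ_s - 1)` into `(λ_{s⁻¹} - 1) U`, to which asymptotic invariance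
    -- applies.
    have h1 : ∀ i, ContinuousLinearMap.adjoint (U i) ∘L
        ((translation H s - 1) * translation H g) =
          ContinuousLinearMap.adjoint ((translation H s⁻¹ - 1) ∘L U i) ∘L translation H g := by
      intro i
      rw [ContinuousLinearMap.adjoint_comp, map_sub, ← ContinuousLinearMap.star_eq_adjoint,
        ← ContinuousLinearMap.star_eq_adjoint, star_translation, inv_inv, star_one]
      rfl
    refine tendsto_zero_iff_norm_tendsto_zero.2 <|
      squeeze_zero (fun _ => norm_nonneg _) (fun i => ?_) (h _ (inv_mem hs))
    change ‖ContinuousLinearMap.adjoint (U i) ∘L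
      ((translation H s - 1) * translation H g)‖ ≤ _
    rw [h1]
    refine (ContinuousLinearMap.opNorm_comp_le _ _).trans ?_
    rw [LinearIsometryEquiv.norm_map]
    exact mul_le_of_le_one_right (norm_nonneg _) (norm_translation_le g)

theorem isClosed_augmentationAlgebra :
    IsClosed (augmentationAlgebra α π : Set (L2 Γ H →L[ℂ] L2 Γ H)) := by
  classical
  obtain ⟨F, hF, hFN, hlim⟩ := exists_folner_net Γ
  have h1 : ∀ η ∈ fcIdeal Γ H, Filter.Tendsto (fun i => star (average H (F i)) * η)
      Filter.atTop (nhds 0) := by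
    intro η hη
    refine tendsto_zero_iff_norm_tendsto_zero.2 ?_
    simp_rw [ContinuousLinearMap.star_eq_adjoint]
    refine tendsto_adjoint_comp_fcIdeal (U := fun i => average H (F i))
      (fun i => norm_average_le (F i)) (fun s hs => ?_) hη
    refine squeeze_zero (fun _ => norm_nonneg _)
      (fun i => norm_translation_sub_one_mul_average_le s (F i)) ?_
    simpa using (hlim s hs).const_mul 2
  exact isClosed_addSandwich (l := Filter.atTop) (isClosed_reducedGroupAlgebra _)
    (f := fun i => average H (F i)) (fun i => norm_average_le (F i))
    (fun i => one_sub_average_mem_fcIdeal (hF i) (hFN i)) h1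

theorem isIntermediate_augmentationAlgebra : IsIntermediate α π (augmentationAlgebra α π) where
  isClosed := isClosed_augmentationAlgebra α π
  le_left := le_addSandwich
  le_right := addSandwich_le (isClosed_crossedProductOf α π ⊤)

end Intermediate

/-! ### Coefficients in the intermediate algebra -/

/-- A positive functional on a C*-algebra is automatically bounded; continuity is what permits the
extension by Hahn–Banach. -/
theorem IsFaithfulInvariantState.exists_bound {Γ : Type u} [Group Γ] {A : Type v} [CStarAlgebra A]
    {α : Γ →* (A ≃⋆ₐ[ℂ] A)} {φ : A →ₗ[ℂ] ℂ} (hφ : IsFaithfulInvariantState α φ) :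
    ∃ M : ℝ, ∀ a, ‖φ a‖ ≤ M * ‖a‖ := by
  let _ := CStarAlgebra.spectralOrder A
  have _ := CStarAlgebra.spectralOrderedRing A
  obtain ⟨M, hM⟩ := PositiveLinearMap.exists_norm_apply_le (PositiveLinearMap.mk₀ φ fun a ha => by
    obtain ⟨b, rfl⟩ := CStarAlgebra.nonneg_iff_eq_star_mul_self.1 ha
    exact hφ.nonneg b)
  exact ⟨M, hM⟩

section UnitOn

variable {Γ : Type u} {H : Type w} [NormedAddCommGroup H] [InnerProductSpace ℂ H]

/-- The inclusion `constOn`, normalized. -/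
def unitOn (H : Type w) [NormedAddCommGroup H] [InnerProductSpace ℂ H] (F : Finset Γ) :
    H →L[ℂ] L2 Γ H :=
  ((√F.card : ℝ) : ℂ)⁻¹ • constOn H F

theorem norm_inv_real_smul {G G' : Type*} [NormedAddCommGroup G] [NormedSpace ℂ G]
    [NormedAddCommGroup G'] [NormedSpace ℂ G'] (r : ℝ) (hr : 0 ≤ r) (T : G →L[ℂ] G') :
    ‖((r : ℝ) : ℂ)⁻¹ • T‖ = ‖T‖ / r := by
  rw [norm_smul, norm_inv, Complex.norm_real, Real.norm_of_nonneg hr, div_eq_inv_mul]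

theorem norm_unitOn_le (F : Finset Γ) : ‖unitOn H F‖ ≤ 1 := by
  rw [unitOn, norm_inv_real_smul _ (Real.sqrt_nonneg _)]
  exact div_le_one_of_le₀ (norm_constOn_le F) (Real.sqrt_nonneg _)

open Classical in
theorem norm_translation_sub_one_comp_unitOn_le [Group Γ] (s : Γ) (F : Finset Γ) :
    ‖(translation H s - 1) ∘L unitOn H F‖ ≤
      2 * √(((F.image fun t => s * t) \ F).card / F.card : ℝ) := by
  rw [unitOn, ContinuousLinearMap.comp_smul, norm_inv_real_smul _ (Real.sqrt_nonneg _),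
    Real.sqrt_div (by positivity), ← mul_div_assoc]
  exact div_le_div_of_nonneg_right (norm_translation_sub_one_comp_constOn_le s F)
    (Real.sqrt_nonneg _)

/-- The functional `T ↦ Φ(U* T U)`, where `U` is the normalized inclusion `unitOn`. -/
def meanFunctional [CompleteSpace H] (Φ : (H →L[ℂ] H) →L[ℂ] ℂ) (F : Finset Γ) :
    (L2 Γ H →L[ℂ] L2 Γ H) →L[ℂ] ℂ :=
  Φ ∘L ContinuousLinearMap.compL ℂ H (L2 Γ H) H (ContinuousLinearMap.adjoint (unitOn H F)) ∘L
    (ContinuousLinearMap.compL ℂ H (L2 Γ H) (L2 Γ H)).flip (unitOn H F)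

theorem meanFunctional_apply [CompleteSpace H] (Φ : (H →L[ℂ] H) →L[ℂ] ℂ) (F : Finset Γ)
    (T : L2 Γ H →L[ℂ] L2 Γ H) : meanFunctional Φ F T =
      Φ (ContinuousLinearMap.adjoint (unitOn H F) ∘L T ∘L unitOn H F) := rfl

end UnitOn

section Mean

variable {Γ : Type u} [Group Γ] {H : Type w} [NormedAddCommGroup H] [InnerProductSpace ℂ H]
  [CompleteSpace H] {A : Type v} [CStarAlgebra A] {α : Γ →* (A ≃⋆ₐ[ℂ] A)}
  {π : A →⋆ₐ[ℂ] (H →L[ℂ] H)}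

theorem norm_apply_of_injective (hπ : Function.Injective π) (a : A) : ‖π a‖ = ‖a‖ :=
  NonUnitalStarAlgHom.norm_map π hπ a

/-- A state can be extended along a faithful representation. -/
theorem IsFaithfulInvariantState.exists_extension {φ : A →ₗ[ℂ] ℂ}
    (hφ : IsFaithfulInvariantState α φ) (hπ : Function.Injective π) :
    ∃ Φ : (H →L[ℂ] H) →L[ℂ] ℂ, ∀ a, Φ (π a) = φ a := by
  obtain ⟨M, hM⟩ := hφ.exists_bound
  let p : Submodule ℂ (H →L[ℂ] H) := LinearMap.range (π : A →ₗ[ℂ] (H →L[ℂ] H))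
  let e : A ≃ₗ[ℂ] p := LinearEquiv.ofInjective (π : A →ₗ[ℂ] (H →L[ℂ] H)) hπ
  have he : ∀ a, ((e a : p) : H →L[ℂ] H) = π a := fun _ => rfl
  let f : StrongDual ℂ p := LinearMap.mkContinuous (φ ∘ₗ e.symm.toLinearMap) M fun x => by
    obtain ⟨a, rfl⟩ := e.surjective x
    have h := hM a
    rw [← norm_apply_of_injective hπ a, ← he] at h
    simpa using h
  -- A bounded linear extension is enough; positivity of `Φ` is never needed.
  obtain ⟨Φ, hΦ, -⟩ := exists_extension_norm_eq p f
  refine ⟨Φ, fun a => ?_⟩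
  rw [← he, hΦ]
  simp [f]

/-- The factor `U* S` is kept intact because it tends to zero when `S` is in the ideal of the
FC-center. -/
theorem norm_meanFunctional_mul_le (Φ : (H →L[ℂ] H) →L[ℂ] ℂ) (F : Finset Γ)
    (S T : L2 Γ H →L[ℂ] L2 Γ H) : ‖meanFunctional Φ F (S * T)‖ ≤
      ‖Φ‖ * (‖ContinuousLinearMap.adjoint (unitOn H F) ∘L S‖ * ‖T‖) := by
  rw [meanFunctional_apply]
  refine (Φ.le_opNorm _).trans (mul_le_mul_of_nonneg_left ?_ (norm_nonneg _))
  have h : ContinuousLinearMap.adjoint (unitOn H F) ∘L (S * T) ∘L unitOn H F =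
      (ContinuousLinearMap.adjoint (unitOn H F) ∘L S) ∘L (T ∘L unitOn H F) := rfl
  rw [h]
  refine (ContinuousLinearMap.opNorm_comp_le _ _).trans
    (mul_le_mul_of_nonneg_left ?_ (norm_nonneg _))
  exact (ContinuousLinearMap.opNorm_comp_le _ _).trans
    (mul_le_of_le_one_right (norm_nonneg _) (norm_unitOn_le F))

theorem norm_meanFunctional_le (Φ : (H →L[ℂ] H) →L[ℂ] ℂ) (F : Finset Γ)
    (T : L2 Γ H →L[ℂ] L2 Γ H) : ‖meanFunctional Φ F T‖ ≤ ‖Φ‖ * ‖T‖ := by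
  have h := norm_meanFunctional_mul_le Φ F 1 T
  rw [one_mul] at h
  refine h.trans (mul_le_mul_of_nonneg_left (mul_le_of_le_one_left (norm_nonneg _) ?_)
    (norm_nonneg _))
  change ‖ContinuousLinearMap.adjoint (unitOn H F)‖ ≤ 1
  rw [LinearIsometryEquiv.norm_map]
  exact norm_unitOn_le F

open Classical in
theorem meanFunctional_coeffRep_mul_translation {φ : A →ₗ[ℂ] ℂ}
    (hφ : IsFaithfulInvariantState α φ) {Φ : (H →L[ℂ] H) →L[ℂ] ℂ} (hΦ : ∀ a, Φ (π a) = φ a)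
    (F : Finset Γ) (a : A) (g : Γ) :
    meanFunctional Φ F (coeffRep α π a * translation H g) =
      φ a * ((F.card : ℂ)⁻¹ * (F.filter fun t => g⁻¹ * t ∈ F).card) := by
  have h : ContinuousLinearMap.adjoint (unitOn H F) ∘L (coeffRep α π a * translation H g) ∘L
      unitOn H F = (F.card : ℂ)⁻¹ • ∑ t ∈ F, if g⁻¹ * t ∈ F then π (α t⁻¹ a) else 0 := by
    rw [← compress_coeffRep_mul_translation, unitOn, map_smulₛₗ, ContinuousLinearMap.comp_smul,
      ContinuousLinearMap.comp_smul, ContinuousLinearMap.smul_comp, smul_smul]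
    congr 1
    rw [map_inv₀, Complex.conj_ofReal, ← mul_inv, ← Complex.ofReal_mul,
      Real.mul_self_sqrt (by positivity), Complex.ofReal_natCast]
  rw [meanFunctional_apply, h, map_smul, map_sum]
  have h2 : ∀ t ∈ F, Φ (if g⁻¹ * t ∈ F then π (α t⁻¹ a) else 0) =
      if g⁻¹ * t ∈ F then φ a else 0 := by
    intro t _
    split_ifs
    · rw [hΦ, hφ.invariant]
    · exact map_zero Φ
  rw [Finset.sum_congr rfl h2, ← Finset.sum_filter, Finset.sum_const, smul_eq_mul, nsmul_eq_mul]
  ring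

theorem meanFunctional_coeffRep {φ : A →ₗ[ℂ] ℂ}
    (hφ : IsFaithfulInvariantState α φ) {Φ : (H →L[ℂ] H) →L[ℂ] ℂ} (hΦ : ∀ a, Φ (π a) = φ a)
    {F : Finset Γ} (hF : F.Nonempty) (a : A) : meanFunctional Φ F (coeffRep α π a) = φ a := by
  classical
  have h := meanFunctional_coeffRep_mul_translation hφ hΦ F a 1
  have hc : (F.card : ℂ) ≠ 0 := by exact_mod_cast hF.card_pos.ne'
  rw [translation_one, mul_one, Finset.filter_true_of_mem (by simp), inv_mul_cancel₀ hc,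
    mul_one] at h
  exact h

/-- On `σ(a) λ_g` the functional is `φ(a)` times a number depending only on `F` and `g`; linearity
and continuity then give all of `C*_r(Γ)`. -/
theorem meanFunctional_coeffRep_mul {φ : A →ₗ[ℂ] ℂ}
    (hφ : IsFaithfulInvariantState α φ) {Φ : (H →L[ℂ] H) →L[ℂ] ℂ} (hΦ : ∀ a, Φ (π a) = φ a)
    (F : Finset Γ) (a : A) {c : L2 Γ H →L[ℂ] L2 Γ H}
    (hc : c ∈ reducedGroupAlgebra H (⊤ : Subgroup Γ)) :
    meanFunctional Φ F (coeffRep α π a * c) = φ a * meanFunctional Φ F c := by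
  classical
  have hcont : Continuous fun c : L2 Γ H →L[ℂ] L2 Γ H =>
      meanFunctional Φ F (coeffRep α π a * c) :=
    (meanFunctional Φ F).continuous.comp (continuous_const_mul _)
  refine closure_span_subset
    (P := LinearMap.eqLocus ((meanFunctional Φ F).toLinearMap ∘ₗ
      LinearMap.mulLeft ℂ (coeffRep α π a)) (φ a • (meanFunctional Φ F).toLinearMap))
    (isClosed_eq hcont ((meanFunctional Φ F).continuous.const_smul (φ a))) ?_
    (reducedGroupAlgebra_top_subset hc)
  rintro _ ⟨g, rfl⟩
  change meanFunctional Φ F (coeffRep α π a * translation H g) =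
    φ a * meanFunctional Φ F (translation H g)
  have h := meanFunctional_coeffRep_mul_translation hφ hΦ F 1 g
  rw [coeffRep_one, one_mul, hφ.map_one, one_mul] at h
  rw [h, meanFunctional_coeffRep_mul_translation hφ hΦ]

theorem tendsto_meanFunctional_sandwichSpan (Φ : (H →L[ℂ] H) →L[ℂ] ℂ) {ι : Type*} {l : Filter ι}
    {F : ι → Finset Γ} (hF : ∀ s ∈ fcCenter Γ,
      Filter.Tendsto (fun i => ‖(translation H s - 1) ∘L unitOn H (F i)‖) l (nhds 0))
    {X : StarSubalgebra ℂ (L2 Γ H →L[ℂ] L2 Γ H)} {k : L2 Γ H →L[ℂ] L2 Γ H}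
    (hk : k ∈ sandwichSpan (fcIdeal Γ H) X) :
    Filter.Tendsto (fun i => meanFunctional Φ (F i) k) l (nhds 0) := by
  refine tendsto_zero_of_mem_closure_span (L := fun i => (meanFunctional Φ (F i)).toLinearMap)
    (M := ‖Φ‖) (fun i x => norm_meanFunctional_le Φ (F i) x) ?_ hk
  rintro _ ⟨η, hη, x, -, η', -, rfl⟩
  have h := tendsto_adjoint_comp_fcIdeal (U := fun i => unitOn H (F i))
    (fun i => norm_unitOn_le (F i)) hF hη
  rw [mul_assoc]
  refine squeeze_zero_norm (fun i => norm_meanFunctional_mul_le Φ (F i) η (x * η')) ?_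
  simpa using (h.mul_const ‖x * η'‖).const_mul ‖Φ‖

/-- An invariant state is multiplicative on the coefficients of the intermediate algebra. -/
theorem IsFaithfulInvariantState.map_star_mul_self {φ : A →ₗ[ℂ] ℂ}
    (hφ : IsFaithfulInvariantState α φ) (hπ : Function.Injective π) {d : A}
    (hd : coeffRep α π d ∈ augmentationAlgebra α π)
    (hd' : coeffRep α π (star d) ∈ augmentationAlgebra α π) :
    φ (star d * d) = φ (star d) * φ d := by
  classical
  obtain ⟨Φ, hΦ⟩ := hφ.exists_extension hπ
  obtain ⟨F, hF, -, hlim⟩ := exists_folner_net Γ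
  have hU : ∀ s ∈ fcCenter Γ, Filter.Tendsto
      (fun i => ‖(translation H s - 1) ∘L unitOn H (F i)‖) Filter.atTop (nhds 0) := by
    intro s hs
    refine squeeze_zero (fun i => norm_nonneg ((translation H s - 1) ∘L unitOn H (F i)))
      (fun i => norm_translation_sub_one_comp_unitOn_le s (F i)) ?_
    simpa using ((hlim s hs).sqrt).const_mul 2
  obtain ⟨c, hc, k, hk, hck⟩ := id hd
  have hdk := addSandwich_mul_mem hd' hk
  have h1 := tendsto_meanFunctional_sandwichSpan Φ hU hk
  have h2 := tendsto_meanFunctional_sandwichSpan Φ hU hdk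
  -- This holds exactly for each Følner set: split `σ(d* d) = σ(d*) c + σ(d*) k` and evaluate the
  -- first term by `meanFunctional_coeffRep_mul`. Only the two terms involving `k` depend on `i`,
  -- and both vanish in the limit.
  have h3 : ∀ i, φ (star d * d) = φ (star d) * (φ d - meanFunctional Φ (F i) k) +
      meanFunctional Φ (F i) (coeffRep α π (star d) * k) := by
    intro i
    have h4 : meanFunctional Φ (F i) c = φ d - meanFunctional Φ (F i) k := by
      rw [← meanFunctional_coeffRep hφ hΦ (hF i) d, ← hck, map_add, add_sub_cancel_right]
    rw [← h4, ← meanFunctional_coeffRep_mul hφ hΦ (F i) _ hc, ← map_add, ← mul_add,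
      ← meanFunctional_coeffRep hφ hΦ (hF i), coeffRep_mul, ← hck]
  have h5 : Filter.Tendsto (fun _ : Finset (fcCenter Γ) × ℕ => φ (star d * d)) Filter.atTop
      (nhds (φ (star d) * (φ d - 0) + 0)) :=
    Filter.Tendsto.congr (fun i => (h3 i).symm) (((h1.const_sub _).const_mul _).add h2)
  rw [sub_zero, add_zero] at h5
  exact tendsto_nhds_unique tendsto_const_nhds h5

end Mean

/-! ### The intermediate algebra is not a crossed product -/

section NotCanonical

variable {Γ : Type u} [Group Γ] {H : Type w} [NormedAddCommGroup H] [InnerProductSpace ℂ H]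
  [CompleteSpace H] {A : Type v} [CStarAlgebra A] {α : Γ →* (A ≃⋆ₐ[ℂ] A)}
  {π : A →⋆ₐ[ℂ] (H →L[ℂ] H)}

/-- The matrix coefficient of an operator on `ℓ²(Γ, H)` at the identity of `Γ`. -/
def coeffAtOne (Γ : Type u) [Group Γ] (H : Type w) [NormedAddCommGroup H]
    [InnerProductSpace ℂ H] [CompleteSpace H] : (L2 Γ H →L[ℂ] L2 Γ H) →L[ℂ] (H →L[ℂ] H) :=
  ContinuousLinearMap.compL ℂ H (L2 Γ H) H (ContinuousLinearMap.adjoint (constOn H {(1 : Γ)})) ∘L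
    (ContinuousLinearMap.compL ℂ H (L2 Γ H) (L2 Γ H)).flip (constOn H {(1 : Γ)})

open Classical in
theorem coeffAtOne_coeffRep_mul_translation (a : A) (g : Γ) :
    coeffAtOne Γ H (coeffRep α π a * translation H g) = if g = 1 then π a else 0 := by
  have h := compress_coeffRep_mul_translation α π {(1 : Γ)} a g
  rw [Finset.sum_singleton] at h
  refine Eq.trans h ?_
  simp

/-- On monomials the coefficient at the identity is `π d` or zero. This extends to the closure
because `π` is isometric, so that `π(D)` is closed. -/
theorem coeffAtOne_mem (hπ : Function.Injective π) {D : StarSubalgebra ℂ A}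
    (hDc : IsClosed (D : Set A)) (hD : ∀ (g : Γ), ∀ d ∈ D, α g d ∈ D)
    {T : L2 Γ H →L[ℂ] L2 Γ H} (hT : T ∈ crossedProductOf α π D) :
    ∃ d ∈ D, π d = coeffAtOne Γ H T := by
  classical
  let P : Submodule ℂ (H →L[ℂ] H) :=
    D.toSubalgebra.toSubmodule.map (π : A →ₗ[ℂ] (H →L[ℂ] H))
  have hiso : Isometry π := AddMonoidHomClass.isometry_of_norm π (norm_apply_of_injective hπ)
  have hP : IsClosed (P : Set (H →L[ℂ] H)) := hiso.isClosedEmbedding.isClosedMap _ hDc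
  refine closure_span_subset (P := P.comap (coeffAtOne Γ H).toLinearMap)
    (hP.preimage (coeffAtOne Γ H).continuous) ?_ (crossedProductOf_subset α π hD hT)
  rintro _ ⟨d, hd, g, rfl⟩
  change coeffAtOne Γ H _ ∈ P
  rw [coeffAtOne_coeffRep_mul_translation]
  split_ifs
  · exact ⟨d, hd, rfl⟩
  · exact zero_mem P

open Classical in
/-- If the intermediate algebra is the crossed product of `D`, then `D` contains the coefficients
of `(λ_g - 1) σ(a) (λ_h - 1)`. -/
theorem add_mem_of_augmentationAlgebra_eq (hπ : Function.Injective π) {D : StarSubalgebra ℂ A}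
    (hDc : IsClosed (D : Set A)) (hD : ∀ (g : Γ), ∀ d ∈ D, α g d ∈ D)
    (hB : augmentationAlgebra α π = crossedProductOf α π D) {g h : Γ} (hg : g ∈ fcCenter Γ)
    (hh : h ∈ fcCenter Γ) (hg1 : g ≠ 1) (hh1 : h ≠ 1) (a : A) :
    (if g * h = 1 then α g a else 0) + a ∈ D := by
  have hT : (translation H g - 1) * coeffRep α π a * (translation H h - 1) ∈
      augmentationAlgebra α π :=
    sandwichSpan_subset_addSandwich (mul_mul_mem_sandwichSpan
      (translation_sub_one_mem_fcIdeal hg) (coeffRep_mem_crossedProductOf α π trivial)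
      (translation_sub_one_mem_fcIdeal hh))
  rw [hB] at hT
  obtain ⟨d, hd, hdT⟩ := coeffAtOne_mem hπ hDc hD hT
  -- Of the four monomials, those with group element `g` and `h` have no coefficient at the
  -- identity, and the one with `gh` has one only if `gh = 1`.
  have hexp : (translation H g - 1) * coeffRep α π a * (translation H h - 1) =
      coeffRep α π (α g a) * translation H (g * h) - coeffRep α π (α g a) * translation H g -
        coeffRep α π a * translation H h + coeffRep α π a * translation H 1 := by
    rw [← translation_mul, ← mul_assoc, ← translation_mul_coeffRep, translation_one]
    noncomm_ring
  rw [hexp, map_add, map_sub, map_sub] at hdT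
  simp only [coeffAtOne_coeffRep_mul_translation, hg1, hh1, if_true, if_false, sub_zero] at hdT
  have : d = (if g * h = 1 then α g a else 0) + a := by
    apply hπ
    rw [hdT, map_add]
    split_ifs <;> simp
  rwa [← this]

/-- If the intermediate algebra is the crossed product of `D`, then `D` consists of scalars. -/
theorem eq_algebraMap_of_augmentationAlgebra_eq {φ : A →ₗ[ℂ] ℂ}
    (hφ : IsFaithfulInvariantState α φ) (hπ : Function.Injective π) {D : StarSubalgebra ℂ A}
    (hB : augmentationAlgebra α π = crossedProductOf α π D) {d : A} (hd : d ∈ D) :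
    d = algebraMap ℂ A (φ d) := by
  have hmem : ∀ b ∈ D, coeffRep α π b ∈ augmentationAlgebra α π := fun b hb => by
    rw [hB]
    exact coeffRep_mem_crossedProductOf α π hb
  -- For the centered element `b = d - φ(d)`, multiplicativity gives `φ(b* b) = 0`.
  have hb : d - algebraMap ℂ A (φ d) ∈ D := sub_mem hd (algebraMap_mem D _)
  have hφb : φ (d - algebraMap ℂ A (φ d)) = 0 := by
    rw [map_sub, Algebra.algebraMap_eq_smul_one, map_smul, hφ.map_one, smul_eq_mul, mul_one,
      sub_self]
  have h := hφ.map_star_mul_self hπ (hmem _ hb) (hmem _ (star_mem hb))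
  rw [hφb, mul_zero] at h
  exact sub_eq_zero.1 (hφ.faithful _ h)

end NotCanonical

/-! ### Choosing group elements and functions -/

theorem exists_ne_ne_of_two_lt_card {X : Type*} (h : 2 < ENat.card X) (x y : X) :
    ∃ z, z ≠ x ∧ z ≠ y := by
  by_contra! hz
  have h1 : (Set.univ : Set X) ⊆ {x, y} := fun z _ => by
    by_cases hzx : z = x
    · exact Or.inl hzx
    · exact Or.inr (hz z hzx)
  have h2 := (Set.encard_le_encard h1).trans (Set.encard_insert_le {y} x)
  rw [Set.encard_univ, Set.encard_singleton, one_add_one_eq_two] at h2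
  exact absurd h2 (not_le.2 h)

theorem exists_mem_fcCenter_ne_one {Γ : Type u} [Group Γ] (hΓ : ¬ IsICC Γ) :
    ∃ g ∈ fcCenter Γ, g ≠ 1 := by
  simp only [IsICC, not_forall] at hΓ
  obtain ⟨g, hg, hfin⟩ := hΓ
  exact ⟨g, Set.not_infinite.1 hfin, hg⟩

/-- A third point `y` is separated from `x` and `g⁻¹ x` by a Urysohn function `f ≥ 0`. Then `g f +
f` vanishes at `x` and is at least `1` at `y`. -/
theorem exists_add_actionOnFunctions_ne_algebraMap {Γ : Type u} [Group Γ]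
    {X : Type v} [TopologicalSpace X] [CompactSpace X] [T2Space X] [MulAction Γ X]
    [ContinuousConstSMul Γ X] (hX : 2 < ENat.card X) (x : X) (g : Γ) :
    ∃ f : C(X, ℂ), ∀ z : ℂ, actionOnFunctions Γ X g f + f ≠ algebraMap ℂ C(X, ℂ) z := by
  obtain ⟨y, hyx, hyg⟩ := exists_ne_ne_of_two_lt_card hX x (g⁻¹ • x)
  obtain ⟨f, hf0, hf1, hf⟩ := exists_continuous_zero_one_of_isClosed
    (s := {x, g⁻¹ • x}) (t := {y}) (Set.toFinite _).isClosed isClosed_singleton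
    (by simp [hyx, hyg])
  refine ⟨⟨fun x => (f x : ℂ), Complex.continuous_ofReal.comp f.continuous⟩, fun z hz => ?_⟩
  have hx := DFunLike.congr_fun hz x
  have hy := DFunLike.congr_fun hz y
  simp only [ContinuousMap.add_apply, actionOnFunctions_apply, ContinuousMap.coe_mk,
    algebraMap_apply] at hx hy
  rw [← hx] at hy
  have h1 : f x = 0 := hf0 (by simp)
  have h2 : f (g⁻¹ • x) = 0 := hf0 (by simp)
  have h3 : f y = 1 := hf1 rfl
  rw [h1, h2, h3] at hy
  have h4 : f (g⁻¹ • y) + 1 = 0 + 0 := by exact_mod_cast hy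
  linarith [(hf (g⁻¹ • y)).1]

/-! ### Invariant measures as faithful invariant states -/

section Functions

open MeasureTheory

variable {Γ : Type u} [Group Γ] {X : Type v} [TopologicalSpace X] [CompactSpace X]
  [MeasurableSpace X] [BorelSpace X]

theorem integrable_continuousMap (ν : Measure X) [IsFiniteMeasure ν] (f : C(X, ℂ)) :
    Integrable f ν :=
  f.continuous.integrable_of_hasCompactSupport (HasCompactSupport.of_compactSpace f)

/-- Integration of continuous functions as a linear functional. -/
def integralFunctional (ν : Measure X) [IsFiniteMeasure ν] : C(X, ℂ) →ₗ[ℂ] ℂ where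
  toFun f := ∫ x, f x ∂ν
  map_add' f g := integral_add (integrable_continuousMap ν f) (integrable_continuousMap ν g)
  map_smul' c f := integral_const_mul c f

theorem integralFunctional_star_mul_self (ν : Measure X) [IsFiniteMeasure ν] (f : C(X, ℂ)) :
    integralFunctional ν (star f * f) = ((∫ x, Complex.normSq (f x) ∂ν : ℝ) : ℂ) := by
  rw [← integral_complex_ofReal]
  exact integral_congr_ae (Filter.Eventually.of_forall fun x =>
    (Complex.normSq_eq_conj_mul_self).symm)

theorem isFaithfulInvariantState_integralFunctional [MulAction Γ X] [ContinuousConstSMul Γ X]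
    (ν : Measure X) [IsProbabilityMeasure ν] [ν.IsOpenPosMeasure] [SMulInvariantMeasure Γ X ν] :
    IsFaithfulInvariantState (actionOnFunctions Γ X) (integralFunctional ν) where
  nonneg f := by
    rw [integralFunctional_star_mul_self]
    exact Complex.zero_le_real.2 (integral_nonneg fun x => Complex.normSq_nonneg _)
  map_one := by simp [integralFunctional]
  faithful f hf := by
    have hc : Continuous fun x => Complex.normSq (f x) :=
      Complex.continuous_normSq.comp f.continuous
    rw [integralFunctional_star_mul_self, Complex.ofReal_eq_zero,
      integral_eq_zero_iff_of_nonneg (fun x => Complex.normSq_nonneg _)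
        (hc.integrable_of_hasCompactSupport (HasCompactSupport.of_compactSpace _))] at hf
    -- Full support enters here: a continuous function that vanishes almost everywhere vanishes
    -- everywhere.
    have h0 := (hc.ae_eq_iff_eq ν continuous_zero).1 hf
    ext x
    exact Complex.normSq_eq_zero.1 (congrFun h0 x)
  invariant g f := integral_smul_eq_self (g := g⁻¹) (fun x => f x)

end Functions

end CrossedProd

end

/-! ### The two cases of the theorem -/

theorem mainTheorem5 (Γ : Type u) [Group Γ] (hΓ : ¬ CrossedProd.IsICC Γ) :
    (∀ (A : Type v) [CStarAlgebra A] (α : Γ →* (A ≃⋆ₐ[ℂ] A)) (φ : A →ₗ[ℂ] ℂ),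
        CrossedProd.IsFaithfulInvariantState α φ →
        (∃ a : A, ∀ z : ℂ, a ≠ algebraMap ℂ A z) →
        2 < ENat.card (CrossedProd.fcCenter Γ) →
        ∀ (H : Type w) [NormedAddCommGroup H] [InnerProductSpace ℂ H] [CompleteSpace H]
          (π : A →⋆ₐ[ℂ] (H →L[ℂ] H)), Function.Injective π →
        ∃ B : StarSubalgebra ℂ (CrossedProd.L2 Γ H →L[ℂ] CrossedProd.L2 Γ H),
          (B : Set (CrossedProd.L2 Γ H →L[ℂ] CrossedProd.L2 Γ H)) =
            CrossedProd.augmentationSum α π ∧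
          CrossedProd.IsIntermediate α π B ∧
          ¬ CrossedProd.IsCanonicalCrossedProduct α π B) ∧
    (∀ (X : Type v) [TopologicalSpace X] [CompactSpace X] [T2Space X] [MeasurableSpace X]
        [BorelSpace X] [MulAction Γ X] [ContinuousConstSMul Γ X]
        (ν : MeasureTheory.Measure X) [MeasureTheory.IsProbabilityMeasure ν]
        [ν.IsOpenPosMeasure] [MeasureTheory.SMulInvariantMeasure Γ X ν],
        2 < ENat.card X →
        ∀ (H : Type w) [NormedAddCommGroup H] [InnerProductSpace ℂ H] [CompleteSpace H]
          (π : C(X, ℂ) →⋆ₐ[ℂ] (H →L[ℂ] H)), Function.Injective π →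
        ∃ B : StarSubalgebra ℂ (CrossedProd.L2 Γ H →L[ℂ] CrossedProd.L2 Γ H),
          (B : Set (CrossedProd.L2 Γ H →L[ℂ] CrossedProd.L2 Γ H)) =
            CrossedProd.augmentationSum (CrossedProd.actionOnFunctions Γ X) π ∧
          CrossedProd.IsIntermediate (CrossedProd.actionOnFunctions Γ X) π B ∧
          ¬ CrossedProd.IsCanonicalCrossedProduct (CrossedProd.actionOnFunctions Γ X) π B) := by

  classical
  refine ⟨?_, ?_⟩
  · intro A _ α φ hφ ⟨a, ha⟩ hcard H _ _ _ π hπ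
    refine ⟨CrossedProd.augmentationAlgebra α π, CrossedProd.coe_augmentationAlgebra α π,
      CrossedProd.isIntermediate_augmentationAlgebra α π, ?_⟩
    rintro ⟨D, hDc, hD, hB⟩
    obtain ⟨g, hg, -⟩ := CrossedProd.exists_ne_ne_of_two_lt_card hcard 1 1
    -- Avoiding both `1` and `g⁻¹` requires a third element of the FC-center; then `gh ≠ 1`, and the
    -- coefficient is `a` itself.
    obtain ⟨h, hh, hhg⟩ := CrossedProd.exists_ne_ne_of_two_lt_card hcard 1 g⁻¹
    have hmem := CrossedProd.add_mem_of_augmentationAlgebra_eq hπ hDc hD hB g.2 h.2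
      (by simpa using hg) (by simpa using hh) a
    have hgh : (g : Γ) * h ≠ 1 := fun hgh => hhg (eq_inv_of_mul_eq_one_right (Subtype.ext hgh))
    rw [if_neg hgh, zero_add] at hmem
    exact ha _ (CrossedProd.eq_algebraMap_of_augmentationAlgebra_eq hφ hπ hB hmem)
  · intro X _ _ _ _ _ _ _ ν _ _ _ hcard H _ _ _ π hπ
    refine ⟨CrossedProd.augmentationAlgebra _ π, CrossedProd.coe_augmentationAlgebra _ π,
      CrossedProd.isIntermediate_augmentationAlgebra _ π, ?_⟩
    rintro ⟨D, hDc, hD, hB⟩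
    obtain ⟨g, hg, hg1⟩ := CrossedProd.exists_mem_fcCenter_ne_one hΓ
    obtain ⟨x⟩ := (MeasureTheory.nonempty_of_isProbabilityMeasure ν : Nonempty X)
    obtain ⟨f, hf⟩ := CrossedProd.exists_add_actionOnFunctions_ne_algebraMap hcard x g
    -- The FC-center may have only two elements, so `h = g⁻¹` is taken and the coefficient is `g f +
    -- f`.
    have hmem := CrossedProd.add_mem_of_augmentationAlgebra_eq hπ hDc hD hB hg (inv_mem hg)
      hg1 (inv_ne_one.2 hg1) f
    rw [if_pos (mul_inv_cancel g)] at hmem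
    exact hf _ (CrossedProd.eq_algebraMap_of_augmentationAlgebra_eq
      (CrossedProd.isFaithfulInvariantState_integralFunctional ν) hπ hB hmem)
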